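/- **Setting.** Let $\hat\Sigma$ be a simplicial complex on a set of vertices $X$, i.e. a family of finite subsets of $X$ that contains $\varnothing$ and is closed under taking subsets; write $\tau\prec\sigma$ if $\tau\subseteq\sigma$ and $|\sigma\setminus\tau|=1$. Let $m:\hat\Sigma\to(0,\infty)$. Put $\Sigma=\hat\Sigma$ if the sum of $m$ over all vertices $\{x\}\in\hat\Sigma$ is finite, and $\Sigma=\hat\Sigma\setminus\{\varnothing\}$ otherwise, and assume $\sum_{\sigma\succ\tau}m(\sigma)<\infty$ for all $\tau\in\Sigma$. Let $\Sigma_k$ be the set of $\tau\in\Sigma$ with $|\tau|=k+1$. Let $\delta$ be a coboundary operator: a linear map on the functions $\Sigma\to\mathbb C$ with $\delta\omega(\sigma)=\sum_{\tau\prec\sigma}\theta(\tau,\sigma)\omega(\tau)$, where $\theta(\tau,\sigma)=\delta1_\tau(\sigma)\in\{\pm1,0\}$ is nonzero iff $\tau\prec\sigma$, and $\delta\delta=0$. Let $$\partial\omega(\rho)=\frac1{m(\rho)}\sum_{\tau\succ\rho}m(\tau)\theta(\rho,\tau)\omega(\tau)$$ on the space of all $\omega$ with $\sum_{\tau\succ\rho}m(\tau)|\omega(\tau)|<\infty$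 for every $\rho\in\Sigma$. In the Hilbert space $\ell^2=\ell^2(\Sigma,m)$, with squared norm $\|\omega\|_2^2=\sum_{\Sigma}m|\omega|^2$, let $\partial_N$ be the restriction of $\partial$ to all $\omega\in\ell^2$ with $\partial\omega\in\ell^2$. Let $\delta_D$ be the restriction of $\delta$ to all $\omega\in\ell^2$ for which there are finitely supported $\omega_n$ with $\|\omega_n-\omega\|_2^2+\|\delta(\omega_n-\omega)\|_2^2\to0$. Let $\Delta=\delta_D\partial_N+\partial_N\delta_D$ on its natural domain, and let $\delta_{D,k}$ and $\Delta_k$ be the restrictions of $\delta_D$ and $\Delta$ to $\ell^2(\Sigma_k,m)$, the subspace of forms supported on $\Sigma_k$. (Thus $\delta_{D,-1}$ acts on $\ell^2(\Sigma_{-1},m)$, which is $\{0\}$ unless $\varnothing\in\Sigma$.) For $\rho\in\Sigma$, the link graph $b_\rho$ has the vertices $v\notin\rho$ with $\rho\cup\{v\}\in\hat\Sigma$ and the edge weights $b_\rho(v,v')=m(\rho\cup\{v,v'\})$ if $v\ne v'$ and $\rho\cup\{v,v'\}\in\hat\Sigma$, and $b_\rho(v,v')=0$ otherwise. A connected weighted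 graph $b$ is recurrent if the Markov chain with transition probabilities $b(x,y)/\sum_zb(x,z)$, started in any vertex $x$, almost surely visits every vertex $y$ at some positive time; the graph with one vertex (where the chain stays put) counts as recurrent. **Corollary (Weak Hodge decomposition and Hodge theorem).** Suppose that for every $\rho\in\Sigma$ all connected components of $b_\rho$ are recurrent. Then there is the orthogonal decomposition $$\ell^2=\ker\Delta\oplus\overline{\mathrm{range}(\delta_D)}\oplus\overline{\mathrm{range}(\partial_N)}.$$ Moreover, for all $k\ge0$, $\overline{\mathrm{range}(\delta_{D,k-1})}\subseteq\ker\delta_{D,k}$, and the reduced relative cohomology $$\ker(\delta_{D,k})/\overline{\mathrm{range}(\delta_{D,k-1})}$$ is isometrically isomorphic to $\ker\Delta_k$, each class being mapped to a harmonic representative. -/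

import Mathlib

open MeasureTheory Filter Topology
open scoped ENNReal

noncomputable section

/-! ### Weighted graphs and recurrence -/

/-- A (locally summable) weighted graph `b` over the vertex set `V`. -/
structure WeightedGraph (V : Type*) where
  b : V → V → ℝ
  nonneg : ∀ x y, 0 ≤ b x y
  symm : ∀ x y, b x y = b y x
  diag : ∀ x, b x x = 0
  summable : ∀ x, Summable fun y => b x y

namespace WeightedGraph

variable {V : Type*}

/-- Vertices `x`, `y` are adjacent if `b x y > 0`. -/
def toSimpleGraph (G : WeightedGraph V) : SimpleGraph V where
  Adj x y := 0 < G.b x y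
  symm := ⟨fun x y (h : 0 < G.b x y) => (G.symm x y ▸ h : 0 < G.b y x)⟩
  loopless := ⟨fun x (h : 0 < G.b x x) => by rw [G.diag x] at h; exact lt_irrefl _ h⟩

/-- The graph obtained by restricting `b` to a set of vertices. -/
def induce (G : WeightedGraph V) (s : Set V) : WeightedGraph s where
  b x y := G.b x y
  nonneg x y := G.nonneg x y
  symm x y := G.symm x y
  diag x := G.diag x
  summable x := (G.summable x).subtype s

open Classical in
/-- Transition probabilities `p(x, y) = b(x, y) / ∑_z b(x, z)` of the Markov chain of the graph.
At a vertex without neighbours, where the quotient is `0 / 0`, the chain stays put. -/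
def transition (G : WeightedGraph V) (x y : V) : ℝ :=
  if ∑' z, G.b x z = 0 then (if x = y then 1 else 0) else G.b x y / ∑' z, G.b x z

/-- The space of trajectories `Y : ℕ → V`, with the product of the discrete `σ`-algebras. -/
def Trajectory (_G : WeightedGraph V) : Type _ := ℕ → V

instance (G : WeightedGraph V) : MeasurableSpace G.Trajectory :=
  @MeasurableSpace.pi ℕ (fun _ => V) (fun _ => ⊤)

/-- `P` is the law of the Markov chain of the graph started in `x`, i.e. the probability measure
under which the chain starts in `x` and runs through `w 0 = x, w 1, …, w n` with probability
`p(w 0, w 1) ⋯ p(w (n - 1), w n)`. -/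
structure IsMarkovLaw (G : WeightedGraph V) (x : V) (P : Measure G.Trajectory) : Prop where
  isProbabilityMeasure : IsProbabilityMeasure P
  start : P {Y | Y 0 = x} = 1
  cylinder : ∀ (n : ℕ) (w : ℕ → V), w 0 = x →
    P {Y | ∀ i ≤ n, Y i = w i}
      = ∏ i ∈ Finset.range n, ENNReal.ofReal (G.transition (w i) (w (i + 1)))

/-- A (connected) graph is recurrent if its Markov chain, started in any vertex `x`, almost surely
visits every vertex `y` at some positive time. -/
def IsRecurrent (G : WeightedGraph V) : Prop :=
  ∀ x y : V, ∃ P : Measure G.Trajectory, G.IsMarkovLaw x P ∧ P {Y | ∃ k : ℕ, 0 < k ∧ Y k = y} = 1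

end WeightedGraph

/-! ### Weighted simplicial complexes -/

/-- `τ` is a face of `σ` (and `σ` a coface of `τ`). -/
def IsFace {X : Type*} (τ σ : Finset X) : Prop := τ ⊆ σ ∧ σ.card = τ.card + 1

/-- A simplicial complex `Σ̂` of finite sets of vertices (the empty simplex included), with a
positive weight function; the values of `weight` off `faces` are irrelevant. -/
structure PreWeightedComplex (X : Type*) where
  faces : Set (Finset X)
  empty_mem : ∅ ∈ faces
  down_closed : ∀ σ ∈ faces, ∀ τ ⊆ σ, τ ∈ faces
  weight : Finset X → ℝ
  weight_pos : ∀ σ ∈ faces, 0 < weight σ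

/-- The set `Σ`: all of `Σ̂` if the vertices have finite total weight, and `Σ̂ \ {∅}` otherwise. -/
def PreWeightedComplex.simplices {X : Type*} (K : PreWeightedComplex X) : Set (Finset X) :=
  {τ | τ ∈ K.faces ∧
    (τ = ∅ → Summable fun v : {v : Finset X // v ∈ K.faces ∧ v.card = 1} => K.weight v)}

/-- A weighted simplicial complex `(Σ, m)`, with locally summable `m`. -/
structure WeightedComplex (X : Type*) extends PreWeightedComplex X where
  locally_summable : ∀ τ ∈ toPreWeightedComplex.simplices,
    Summable fun σ : {σ : Finset X // σ ∈ faces ∧ IsFace τ σ} => weight σ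

namespace WeightedComplex

variable {X : Type*} (K : WeightedComplex X)

/-- The simplices `Σ` as a type. -/
abbrev Simplex : Type _ := {τ : Finset X // τ ∈ K.simplices}

/-- The weight function `m` on `Σ`. -/
def m (τ : K.Simplex) : ℝ := K.weight τ.1

variable {K} in
lemma m_pos (τ : K.Simplex) : 0 < K.m τ := K.weight_pos τ.1 τ.2.1

/-! ### Links -/

section Link

variable [DecidableEq X]

/-- The vertices of the link of `ρ`. -/
def link (ρ : K.Simplex) : Set X := {v | v ∉ ρ.1 ∧ insert v ρ.1 ∈ K.faces}

open Classical in
/-- The link graph `b_ρ`, `b_ρ(v, v') = m(vv'ρ)` for `v ≠ v'` (and `0` if `vv'ρ` is not a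
simplex). -/
def linkGraph (ρ : K.Simplex) : WeightedGraph (K.link ρ) where
  b v v' := if v ≠ v' ∧ insert v.1 (insert v'.1 ρ.1) ∈ K.faces then
    K.weight (insert v.1 (insert v'.1 ρ.1)) else 0
  nonneg v v' := by
    split_ifs with h
    · exact (K.weight_pos _ h.2).le
    · exact le_rfl
  symm v v' := by
    simp only [Finset.insert_comm v.1 v'.1, ne_comm (a := v)]
  diag v := by simp
  summable v := by
    have hτ : insert v.1 ρ.1 ∈ K.simplices :=
      ⟨v.2.2, fun h => absurd h (Finset.insert_ne_empty _ _)⟩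
    set s : Set (K.link ρ) := {v' | v ≠ v' ∧ insert v.1 (insert v'.1 ρ.1) ∈ K.faces} with hs
    have hface : ∀ v' : s, IsFace (insert v.1 ρ.1) (insert v.1 (insert v'.1.1 ρ.1)) := by
      rintro ⟨v', h⟩
      refine ⟨Finset.insert_subset_insert _ (Finset.subset_insert _ _), ?_⟩
      have h1 : v'.1 ∉ insert v.1 ρ.1 := by
        rw [Finset.mem_insert, not_or]
        exact ⟨fun e => h.1 (Subtype.ext e.symm), v'.2.1⟩
      rw [Finset.insert_comm, Finset.card_insert_of_notMem h1]
    let f : s → {σ : Finset X // σ ∈ K.faces ∧ IsFace (insert v.1 ρ.1) σ} :=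
      fun v' => ⟨insert v.1 (insert v'.1.1 ρ.1), v'.2.2, hface v'⟩
    have hf : Function.Injective f := by
      rintro ⟨a, ha⟩ ⟨c, hc⟩ h
      have h2 : insert v.1 (insert a.1 ρ.1) = insert v.1 (insert c.1 ρ.1) :=
        congrArg Subtype.val h
      have h3 : a.1 ∈ insert v.1 (insert c.1 ρ.1) := by
        rw [← h2]; simp
      rw [Finset.mem_insert, Finset.mem_insert] at h3
      rcases h3 with h3 | h3 | h3
      · exact absurd (Subtype.ext h3.symm) ha.1
      · exact Subtype.ext (Subtype.ext h3)
      · exact absurd h3 a.2.1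
    have h4 := ((K.locally_summable _ hτ).comp_injective hf)
    have h5 := (summable_subtype_iff_indicator (s := s)
      (f := fun v' : K.link ρ => K.weight (insert v.1 (insert v'.1 ρ.1)))).1 h4
    refine h5.congr fun v' => ?_
    simp only [Set.indicator_apply, hs, Set.mem_ofPred_eq]

/-- All connected components of all link graphs `b_ρ`, `ρ ∈ Σ`, are recurrent. -/
def RecurrentLinks : Prop :=
  ∀ (ρ : K.Simplex) (c : (K.linkGraph ρ).toSimpleGraph.ConnectedComponent),
    ((K.linkGraph ρ).induce c.supp).IsRecurrent

end Link

/-! ### Coboundary and boundary operator on functions -/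

/-- A coboundary operator on `Σ`; `θ(τ, σ) = δ 1_τ (σ)`. -/
structure Coboundary where
  δ : (K.Simplex → ℂ) →ₗ[ℂ] (K.Simplex → ℂ)
  mem_signs : ∀ τ σ, δ (Set.indicator {τ} 1) σ ∈ ({1, -1, 0} : Set ℂ)
  ne_zero_iff : ∀ τ σ, δ (Set.indicator {τ} 1) σ ≠ 0 ↔ IsFace τ.1 σ.1
  apply_eq : ∀ ω σ, δ ω σ =
    ∑ᶠ τ : {τ : K.Simplex // IsFace τ.1 σ.1}, δ (Set.indicator {τ.1} 1) σ * ω τ.1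
  δ_δ : δ ∘ₗ δ = 0

/-! ### The Hilbert space `ℓ²(Σ, m)` -/

instance : MeasurableSpace K.Simplex := ⊤

/-- The discrete measure `m(A) = ∑_{τ ∈ A} m(τ)` on `Σ`. -/
def measure : Measure K.Simplex :=
  Measure.sum fun τ => ENNReal.ofReal (K.m τ) • Measure.dirac τ

/-- The complex Hilbert space `ℓ²(Σ, m)`. -/
abbrev L2 : Type _ := Lp ℂ 2 K.measure

lemma ae_iff {p : K.Simplex → Prop} : (∀ᵐ τ ∂K.measure, p τ) ↔ ∀ τ, p τ := by
  unfold measure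
  rw [Measure.ae_sum_iff' (MeasurableSpace.measurableSet_top)]
  refine forall_congr' fun τ => ?_
  have h0 : ENNReal.ofReal (K.m τ) ≠ 0 := by
    simpa using m_pos τ
  rw [Measure.ae_ennreal_smul_measure_iff h0]
  exact ae_dirac_iff (MeasurableSpace.measurableSet_top)

/-- An element of `ℓ²(Σ, m)` as a function on `Σ` (no two functions on `Σ` agree almost
everywhere). -/
def toFun : K.L2 →ₗ[ℂ] (K.Simplex → ℂ) where
  toFun f := f
  map_add' f g := funext (K.ae_iff.1 (Lp.coeFn_add f g))
  map_smul' c f := funext (K.ae_iff.1 (Lp.coeFn_smul c f))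

/-- The squared `ℓ²`-norm `∑_Σ m |ω|² ∈ [0, ∞]` of an arbitrary function. -/
def sqNorm (ω : K.Simplex → ℂ) : ℝ≥0∞ := ∑' τ, ENNReal.ofReal (K.m τ * ‖ω τ‖ ^ 2)

/-- The subspace `ℓ²(Σ_k, m)` of forms supported on the `k`-simplices, which have `k + 1`
vertices. -/
def level (k : ℤ) : Submodule ℂ K.L2 where
  carrier := {ω | ∀ τ, K.toFun ω τ ≠ 0 → (τ.1.card : ℤ) = k + 1}
  zero_mem' := fun τ h => absurd (by simp) h
  add_mem' := by
    intro a b ha hb τ h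
    by_cases h1 : K.toFun a τ = 0
    · refine hb τ fun h2 => h ?_
      rw [map_add, Pi.add_apply, h1, h2, add_zero]
    · exact ha τ h1
  smul_mem' := by
    intro c a ha τ h
    refine ha τ fun h2 => h ?_
    rw [map_smul, Pi.smul_apply, h2, smul_zero]

lemma toFun_injective : Function.Injective K.toFun := fun _ _ h =>
  Lp.ext (K.ae_iff.2 (congrFun h))

/-- The maximal restriction of an operator on functions to an operator in `ℓ²(Σ, m)`: its graph
consists of all `(ω, η) ∈ ℓ² × ℓ²` with `ω` in the domain of `A` and `η = A ω`, so its domain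
consists of all `ω ∈ ℓ²` in the domain of `A` with `A ω ∈ ℓ²`. -/
def maximal (A : (K.Simplex → ℂ) →ₗ.[ℂ] (K.Simplex → ℂ)) : K.L2 →ₗ.[ℂ] K.L2 :=
  (A.graph.comap (K.toFun.prodMap K.toFun)).toLinearPMap

lemma mem_graph_maximal (A : (K.Simplex → ℂ) →ₗ.[ℂ] (K.Simplex → ℂ)) (ω η : K.L2) :
    (ω, η) ∈ (K.maximal A).graph ↔ ∃ h : K.toFun ω ∈ A.domain, A ⟨K.toFun ω, h⟩ = K.toFun η := by
  unfold maximal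
  rw [Submodule.toLinearPMap_graph_eq]
  · rw [Submodule.mem_comap, LinearPMap.mem_graph_iff]
    constructor
    · rintro ⟨⟨y, hy⟩, h1, h2⟩
      have h1' : y = K.toFun ω := h1
      subst h1'
      exact ⟨hy, h2⟩
    · rintro ⟨h, h2⟩
      exact ⟨⟨_, h⟩, rfl, h2⟩
  · rintro ⟨a, c⟩ h rfl
    refine K.toFun_injective ?_
    rw [map_zero]
    have h' : (K.toFun 0, K.toFun c) ∈ A.graph := h
    exact LinearPMap.graph_fst_eq_zero_snd A h' (map_zero _)

namespace Coboundary

variable {K} (d : K.Coboundary)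

/-- The signs `θ(τ, σ)`. -/
def θ (τ σ : K.Simplex) : ℂ := d.δ (Set.indicator {τ} 1) σ

/-- The boundary operator `∂`, with domain
`D(∂) = {ω | ∑_{τ ≻ ρ} m(τ) |ω(τ)| < ∞ for all ρ ∈ Σ}`. -/
def boundary : (K.Simplex → ℂ) →ₗ.[ℂ] (K.Simplex → ℂ) where
  domain :=
    { carrier := {ω | ∀ ρ : K.Simplex,
        Summable fun τ : {τ : K.Simplex // IsFace ρ.1 τ.1} => K.m τ.1 * ‖ω τ.1‖}
      zero_mem' := fun ρ => by simp
      add_mem' := by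
        intro a b ha hb ρ
        refine Summable.of_nonneg_of_le
          (fun τ => mul_nonneg (m_pos τ.1).le (norm_nonneg _)) (fun τ => ?_) ((ha ρ).add (hb ρ))
        rw [← mul_add]
        exact mul_le_mul_of_nonneg_left (norm_add_le _ _) (m_pos τ.1).le
      smul_mem' := by
        intro c a ha ρ
        refine ((ha ρ).mul_left ‖c‖).congr fun τ => ?_
        rw [Pi.smul_apply, norm_smul]
        ring }
  toFun :=
    { toFun := fun ω ρ => (K.m ρ : ℂ)⁻¹ *
        ∑' τ : {τ : K.Simplex // IsFace ρ.1 τ.1}, (K.m τ.1 : ℂ) * d.θ ρ τ.1 * ω.1 τ.1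
      map_add' := by
        intro a b
        funext ρ
        have hs : ∀ ω : K.Simplex → ℂ,
            (Summable fun τ : {τ : K.Simplex // IsFace ρ.1 τ.1} => K.m τ.1 * ‖ω τ.1‖) →
            Summable fun τ : {τ : K.Simplex // IsFace ρ.1 τ.1} =>
              (K.m τ.1 : ℂ) * d.θ ρ τ.1 * ω τ.1 := by
          intro ω hω
          refine Summable.of_norm_bounded hω fun τ => ?_
          have h1 : ‖d.θ ρ τ.1‖ ≤ 1 := by
            have h := d.mem_signs ρ τ.1
            simp only [Set.mem_insert_iff, Set.mem_singleton_iff] at h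
            rcases h with h | h | h <;> simp [θ, h]
          rw [norm_mul, norm_mul, Complex.norm_real, Real.norm_of_nonneg (m_pos τ.1).le]
          refine mul_le_mul_of_nonneg_right ?_ (norm_nonneg _)
          exact mul_le_of_le_one_right (m_pos τ.1).le h1
        simp only [Pi.add_apply, Submodule.coe_add, mul_add]
        rw [(hs _ (a.2 ρ)).tsum_add (hs _ (b.2 ρ)), mul_add]
      map_smul' := by
        intro c a
        funext ρ
        simp only [Pi.smul_apply, Submodule.coe_smul, smul_eq_mul, RingHom.id_apply]
        rw [mul_left_comm, ← tsum_mul_left (a := c)]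
        congr 1
        refine tsum_congr fun τ => ?_
        ring }

/-- The boundary operator with Neumann boundary conditions: `D(∂_N) = {ω ∈ ℓ² | ∂ω ∈ ℓ²}`. -/
def boundaryN : K.L2 →ₗ.[ℂ] K.L2 := K.maximal d.boundary

/-- The coboundary operator with Neumann boundary conditions: `D(δ_N) = {ω ∈ ℓ² | δω ∈ ℓ²}`. -/
def coboundaryN : K.L2 →ₗ.[ℂ] K.L2 := K.maximal (d.δ.toPMap ⊤)

/-- The quadratic form `𝒬⁺(ω) = ∑_Σ m |δω|²`. -/
def upForm (ω : K.Simplex → ℂ) : ℝ≥0∞ := K.sqNorm (d.δ ω)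

end Coboundary

lemma sqNorm_add_le (ω η : K.Simplex → ℂ) :
    K.sqNorm (ω + η) ≤ 2 * K.sqNorm ω + 2 * K.sqNorm η := by
  unfold sqNorm
  rw [← ENNReal.tsum_mul_left, ← ENNReal.tsum_mul_left, ← ENNReal.tsum_add]
  refine ENNReal.tsum_le_tsum fun τ => ?_
  have hm := (m_pos τ).le
  have h2 : (2 : ℝ≥0∞) = ENNReal.ofReal 2 := by simp
  rw [h2, ← ENNReal.ofReal_mul (by norm_num), ← ENNReal.ofReal_mul (by norm_num),
    ← ENNReal.ofReal_add (by positivity) (by positivity)]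
  refine ENNReal.ofReal_le_ofReal ?_
  have h3 : ‖(ω + η) τ‖ ^ 2 ≤ 2 * ‖ω τ‖ ^ 2 + 2 * ‖η τ‖ ^ 2 := by
    have := norm_add_le (ω τ) (η τ)
    rw [Pi.add_apply]
    nlinarith [sq_nonneg (‖ω τ‖ - ‖η τ‖), norm_nonneg (ω τ + η τ), norm_nonneg (ω τ),
      norm_nonneg (η τ)]
  nlinarith [mul_le_mul_of_nonneg_left h3 hm]

lemma sqNorm_smul (c : ℂ) (ω : K.Simplex → ℂ) :
    K.sqNorm (c • ω) = ENNReal.ofReal (‖c‖ ^ 2) * K.sqNorm ω := by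
  unfold sqNorm
  rw [← ENNReal.tsum_mul_left]
  refine tsum_congr fun τ => ?_
  rw [← ENNReal.ofReal_mul (by positivity), Pi.smul_apply, norm_smul]
  congr 1
  ring

namespace Coboundary

variable {K} (d : K.Coboundary)

/-- The domain `D(Q⁺_D)`: all `ω ∈ ℓ²` with `‖ω_n - ω‖² + 𝒬⁺(ω_n - ω) → 0` for some finitely
supported `ω_n`. -/
def dirichletDomain : Submodule ℂ K.L2 where
  carrier := {ω | ∃ u : ℕ → K.Simplex → ℂ, (∀ n, (Function.support (u n)).Finite) ∧
    Tendsto (fun n => K.sqNorm (u n - K.toFun ω) + d.upForm (u n - K.toFun ω)) atTop (𝓝 0)}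
  zero_mem' := ⟨0, fun n => by simp, by
    simp [sqNorm, upForm]⟩
  add_mem' := by
    rintro a b ⟨u, hu, hu'⟩ ⟨v, hv, hv'⟩
    refine ⟨fun n => u n + v n, fun n => ((hu n).union (hv n)).subset (Function.support_add _ _), ?_⟩
    have h := (ENNReal.Tendsto.const_mul (a := 2) hu' (Or.inr (by simp))).add
      (ENNReal.Tendsto.const_mul (a := 2) hv' (Or.inr (by simp)))
    rw [mul_zero, add_zero] at h
    refine tendsto_of_tendsto_of_tendsto_of_le_of_le tendsto_const_nhds h
      (fun _ => bot_le) fun n => ?_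
    have e : u n + v n - K.toFun (a + b) = (u n - K.toFun a) + (v n - K.toFun b) := by
      rw [map_add]; abel
    have e2 : d.upForm (u n + v n - K.toFun (a + b)) ≤
        2 * d.upForm (u n - K.toFun a) + 2 * d.upForm (v n - K.toFun b) := by
      rw [e]
      unfold upForm
      rw [map_add]
      exact K.sqNorm_add_le _ _
    have e1 := K.sqNorm_add_le (u n - K.toFun a) (v n - K.toFun b)
    rw [← e] at e1
    refine (add_le_add e1 e2).trans (le_of_eq ?_)
    ring
  smul_mem' := by
    rintro c a ⟨u, hu, hu'⟩
    refine ⟨fun n => c • u n, fun n => (hu n).subset (Function.support_const_smul_subset _ _), ?_⟩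
    have h := ENNReal.Tendsto.const_mul (a := ENNReal.ofReal (‖c‖ ^ 2)) hu' (Or.inr (by simp))
    rw [mul_zero] at h
    refine h.congr fun n => ?_
    have e : c • u n - K.toFun (c • a) = c • (u n - K.toFun a) := by
      rw [map_smul, smul_sub]
    rw [e]
    unfold upForm
    rw [map_smul, sqNorm_smul, sqNorm_smul, mul_add]

/-- The coboundary operator with Dirichlet boundary conditions: the restriction of `δ` to
`D(Q⁺_D)`. -/
def coboundaryD : K.L2 →ₗ.[ℂ] K.L2 := d.coboundaryN.domRestrict d.dirichletDomain

end Coboundary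

end WeightedComplex

/-! ### Unbounded operators -/

namespace LinearPMap

variable {H : Type*} [AddCommGroup H] [Module ℂ H]

/-- The composition `B A` of unbounded operators, on `D(BA) = {x ∈ D(A) | A x ∈ D(B)}`. -/
def opComp (B A : H →ₗ.[ℂ] H) : H →ₗ.[ℂ] H :=
  B.comp (A.domRestrict ((B.domain.comap A.toFun).map A.domain.subtype)) (by
    rintro ⟨x, hx1, hx2⟩
    obtain ⟨y, hy, rfl⟩ := hx1
    exact hy)

/-- The kernel of an unbounded operator. -/
def opKer (A : H →ₗ.[ℂ] H) : Submodule ℂ H := (LinearMap.ker A.toFun).map A.domain.subtype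

/-- The range of an unbounded operator. -/
def opRange (A : H →ₗ.[ℂ] H) : Submodule ℂ H := LinearMap.range A.toFun

end LinearPMap

/-- The operator `Δ = δ_D ∂_N + ∂_N δ_D`. -/
def WeightedComplex.Coboundary.laplacian {X : Type*} {K : WeightedComplex X}
    (d : K.Coboundary) : K.L2 →ₗ.[ℂ] K.L2 :=
  d.coboundaryD.opComp d.boundaryN + d.boundaryN.opComp d.coboundaryD

/-- The restriction `δ_{D,k}` of `δ_D` to `ℓ²(Σ_k, m)`. -/
def WeightedComplex.Coboundary.coboundaryDLevel {X : Type*} {K : WeightedComplex X}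
    (d : K.Coboundary) (k : ℤ) : K.L2 →ₗ.[ℂ] K.L2 :=
  d.coboundaryD.domRestrict (K.level k)

/-- The restriction `Δ_k` of `Δ` to `ℓ²(Σ_k, m)`. -/
def WeightedComplex.Coboundary.laplacianLevel {X : Type*} {K : WeightedComplex X}
    (d : K.Coboundary) (k : ℤ) : K.L2 →ₗ.[ℂ] K.L2 :=
  d.laplacian.domRestrict (K.level k)

/-- The reduced relative cohomology
`H^k_rel(Σ) = ker δ_{D,k} / closure (range δ_{D,k-1})`. -/
abbrev WeightedComplex.Coboundary.RelCohomology {X : Type*} {K : WeightedComplex X}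
    (d : K.Coboundary) (k : ℤ) : Type _ :=
  (d.coboundaryDLevel k).opKer ⧸
    ((d.coboundaryDLevel (k - 1)).opRange.topologicalClosure.submoduleOf
      (d.coboundaryDLevel k).opKer)

end

noncomputable section

/-! ### Transition operator and finite-time hitting probabilities of a weighted graph. -/

namespace WeightedGraph

variable {V : Type*} (G : WeightedGraph V)

/-! The operators `δ_D` and `∂_N` are adjoint to each other: `δ_D` is the closure of `δ` on finitely
supported forms, and `∂_N` is the adjoint of that restriction. Hence `ker δ_D = (range ∂_N)ᗮ`, `ker
∂_N = (range δ_D)ᗮ` and `ker Δ = ker δ_D ⊓ ker ∂_N`, all without recurrence. What remains for the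
decomposition is that the two ranges are orthogonal, i.e. `∂_N ∂_N = 0`, which amounts to `⟨δ 1_τ,
∂_N a⟩ = 0` for every simplex `τ` (`inner_δSingle_boundaryN`).

Formally this is the cancellation of signs in a double sum over pairs `v, v'` of link vertices, but
that sum need not converge absolutely. It is the total divergence of the flow `θ(τ,vτ) θ(vτ,vv'τ)
a(vv'τ)` on the link graph of `τ`. The flow is antisymmetric because `δδ = 0`, has finite energy
because `a ∈ ℓ²`, and has absolutely summable divergence because `∂_N a ∈ ℓ²` and `m` is locally
summable.

On a recurrent graph such a flow has total divergence zero (`IsRecurrent.tsum_divergence_eq_zero`).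
Let `h_N` be the probability of hitting a fixed vertex up to time `N`. Then `h_N → 1` pointwise and
the energy of `h_N` tends to zero. Summation by parts pairs the divergence with the gradient of
`h_N`, so the pairing tends to zero by Young's inequality, while dominated convergence sends it to
the total divergence.

For the cohomology, a quotient of a closed subspace by a closed subspace is its orthogonal
complement there, and counting vertices identifies this complement with `ker Δ_k`. -/

lemma tsum_b_nonneg (x : V) : 0 ≤ ∑' z, G.b x z := tsum_nonneg (G.nonneg x)

lemma transition_nonneg (x y : V) : 0 ≤ G.transition x y := by
  unfold transition
  split_ifs
  · exact zero_le_one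
  · exact le_rfl
  · exact div_nonneg (G.nonneg x y) (G.tsum_b_nonneg x)

lemma b_le_tsum (x y : V) : G.b x y ≤ ∑' z, G.b x z :=
  (G.summable x).le_tsum y fun z _ => G.nonneg x z

/-- Detailed balance: the right side is symmetric in `x` and `y`. At a vertex without neighbours
both sides vanish, so the convention for the chain there does no harm. -/
lemma tsum_b_mul_transition (x y : V) : (∑' z, G.b x z) * G.transition x y = G.b x y := by
  by_cases h : ∑' z, G.b x z = 0
  · rw [h, zero_mul]
    exact le_antisymm (G.nonneg x y) (h ▸ G.b_le_tsum x y)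
  · rw [transition, if_neg h, mul_div_cancel₀ _ h]

lemma hasSum_transition (x : V) : HasSum (G.transition x) 1 := by
  classical
  by_cases h : ∑' z, G.b x z = 0
  · have e : G.transition x = fun y => if y = x then 1 else 0 := by
      funext y
      simp [transition, h, eq_comm]
    rw [e]
    exact hasSum_ite_eq x 1
  · have e : G.transition x = fun y => G.b x y / ∑' z, G.b x z := by
      funext y
      simp [transition, h]
    rw [e]
    have := (G.summable x).hasSum.div_const (∑' z, G.b x z)
    rwa [div_self h] at this

open Classical in
/-- The probability that the Markov chain started in `x` visits `y` at one of the times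
`0, …, N`. -/
def hitProb (y : V) : ℕ → V → ℝ
  | 0 => fun x => if x = y then 1 else 0
  | N + 1 => fun x => if x = y then 1 else ∑' z, G.transition x z * hitProb y N z

/-- The transition operator of the Markov chain. -/
def averaging (f : V → ℝ) (x : V) : ℝ := ∑' z, G.transition x z * f z

@[simp] lemma hitProb_self (y : V) (N : ℕ) : G.hitProb y N y = 1 := by
  cases N <;> simp [hitProb]

lemma hitProb_succ_of_ne {x y : V} (h : x ≠ y) (N : ℕ) :
    G.hitProb y (N + 1) x = G.averaging (G.hitProb y N) x := by
  simp [hitProb, h, averaging]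

variable {G} in
lemma summable_transition_mul {f : V → ℝ} (h0 : ∀ x, 0 ≤ f x) (h1 : ∀ x, f x ≤ 1) (x : V) :
    Summable fun z => G.transition x z * f z :=
  Summable.of_nonneg_of_le (fun z => mul_nonneg (G.transition_nonneg x z) (h0 z))
    (fun z => mul_le_of_le_one_right (G.transition_nonneg x z) (h1 z))
    (G.hasSum_transition x).summable

variable {G} in
lemma averaging_nonneg {f : V → ℝ} (h0 : ∀ x, 0 ≤ f x) (x : V) : 0 ≤ G.averaging f x :=
  tsum_nonneg fun z => mul_nonneg (G.transition_nonneg x z) (h0 z)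

variable {G} in
lemma averaging_le_one {f : V → ℝ} (h0 : ∀ x, 0 ≤ f x) (h1 : ∀ x, f x ≤ 1) (x : V) :
    G.averaging f x ≤ 1 :=
  ((summable_transition_mul h0 h1 x).tsum_le_tsum
    (fun z => mul_le_of_le_one_right (G.transition_nonneg x z) (h1 z))
    (G.hasSum_transition x).summable).trans_eq (G.hasSum_transition x).tsum_eq

lemma hitProb_mem (y : V) (N : ℕ) : (∀ x, 0 ≤ G.hitProb y N x) ∧ ∀ x, G.hitProb y N x ≤ 1 := by
  induction N with
  | zero =>
    constructor <;> intro x <;> simp only [hitProb] <;> split_ifs <;> norm_num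
  | succ N ih =>
    constructor <;> intro x <;> by_cases h : x = y
    · simp [h]
    · rw [G.hitProb_succ_of_ne h]
      exact averaging_nonneg ih.1 x
    · simp [h]
    · rw [G.hitProb_succ_of_ne h]
      exact averaging_le_one ih.1 ih.2 x

lemma hitProb_nonneg (y : V) (N : ℕ) (x : V) : 0 ≤ G.hitProb y N x := (G.hitProb_mem y N).1 x

lemma hitProb_le_one (y : V) (N : ℕ) (x : V) : G.hitProb y N x ≤ 1 := (G.hitProb_mem y N).2 x

lemma hitProb_le_succ (y : V) (N : ℕ) (x : V) : G.hitProb y N x ≤ G.hitProb y (N + 1) x := by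
  induction N generalizing x with
  | zero =>
    by_cases h : x = y
    · simp [h]
    · exact (le_of_eq (by simp [hitProb, h])).trans (G.hitProb_nonneg y 1 x)
  | succ N ih =>
    by_cases h : x = y
    · simp [h]
    · rw [G.hitProb_succ_of_ne h, G.hitProb_succ_of_ne h]
      exact (summable_transition_mul (G.hitProb_nonneg y N) (G.hitProb_le_one y N) x).tsum_le_tsum
        (fun z => mul_le_mul_of_nonneg_left (ih z) (G.transition_nonneg x z))
        (summable_transition_mul (G.hitProb_nonneg y _) (G.hitProb_le_one y _) x)

/-! ### Hitting probabilities of a recurrent graph -/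

lemma measurableSet_coord (i : ℕ) (s : Set V) : MeasurableSet {Y : G.Trajectory | Y i ∈ s} :=
  @measurable_pi_apply ℕ (fun _ => V) (fun _ => ⊤) i s MeasurableSpace.measurableSet_top

/-- The trajectories that follow `w` until time `n` and avoid `y` for the next `N` steps. -/
def followAvoid (y : V) (n N : ℕ) (w : ℕ → V) : Set G.Trajectory :=
  {Y | (∀ i ≤ n, Y i = w i) ∧ ∀ k, n < k → k ≤ n + N → Y k ≠ y}

lemma measurableSet_followAvoid (y : V) (n N : ℕ) (w : ℕ → V) :
    MeasurableSet (G.followAvoid y n N w) := by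
  have e : G.followAvoid y n N w = (⋂ i, ⋂ _ : i ≤ n, {Y : G.Trajectory | Y i ∈ ({w i} : Set V)}) ∩
      ⋂ k, ⋂ _ : n < k, ⋂ _ : k ≤ n + N, {Y : G.Trajectory | Y k ∈ ({y}ᶜ : Set V)} := by
    ext Y
    simp [followAvoid]
  rw [e]
  refine MeasurableSet.inter ?_ ?_
  · exact MeasurableSet.iInter fun i => MeasurableSet.iInter fun _ => G.measurableSet_coord _ _
  · exact MeasurableSet.iInter fun i => MeasurableSet.iInter fun _ => MeasurableSet.iInter fun _ =>
      G.measurableSet_coord _ _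

variable {G} in
-- Splits according to the position `z ≠ y` at time `n + 1`. Only a lower bound is claimed: for
-- disjoint measurable events the sum of the measures is at most the measure of the union over any
-- index set, so `V` need not be countable. The position `w n` itself may be `y`, which later covers
-- returns to the starting vertex.
lemma followAvoid_succ_bound {x y : V} {P : Measure G.Trajectory} {N : ℕ}
    (ih : ∀ (n : ℕ) (w : ℕ → V), w 0 = x → w n ≠ y →
      (∏ i ∈ Finset.range n, ENNReal.ofReal (G.transition (w i) (w (i + 1)))) *
        ENNReal.ofReal (1 - G.hitProb y N (w n)) ≤ P (G.followAvoid y n N w))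
    (n : ℕ) (w : ℕ → V) (hw : w 0 = x) :
    (∏ i ∈ Finset.range n, ENNReal.ofReal (G.transition (w i) (w (i + 1)))) *
      ENNReal.ofReal (1 - G.averaging (G.hitProb y N) (w n)) ≤
        P (G.followAvoid y n (N + 1) w) := by
  classical
  set q := ∏ i ∈ Finset.range n, ENNReal.ofReal (G.transition (w i) (w (i + 1)))
  set s : {z : V // z ≠ y} → Set G.Trajectory :=
    fun z => G.followAvoid y (n + 1) N (Function.update w (n + 1) z.1) with hs
  have hsub : ⋃ z, s z ⊆ G.followAvoid y n (N + 1) w := by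
    refine Set.iUnion_subset fun z Y hY => ⟨fun i hi => ?_, fun k hk hk' => ?_⟩
    · rw [hY.1 i (by omega), Function.update_of_ne (by omega)]
    · rcases (show k = n + 1 ∨ n + 1 < k by omega) with rfl | h
      · rw [hY.1 _ le_rfl, Function.update_self]
        exact z.2
      · exact hY.2 k h (by omega)
  have hdisj : Pairwise (Function.onFun Disjoint s) := by
    intro a c hac
    refine Set.disjoint_left.2 fun Y ha hc => hac (Subtype.ext ?_)
    have h1 := ha.1 (n + 1) le_rfl
    have h2 := hc.1 (n + 1) le_rfl
    rw [Function.update_self] at h1 h2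
    exact h1.symm.trans h2
  have hterm : ∀ z : {z : V // z ≠ y},
      q * ENNReal.ofReal (G.transition (w n) z * (1 - G.hitProb y N z)) ≤ P (s z) := by
    intro z
    refine le_trans (le_of_eq ?_) (ih (n + 1) (Function.update w (n + 1) z.1)
      (by rw [Function.update_of_ne (by omega), hw]) (by rw [Function.update_self]; exact z.2))
    rw [Finset.prod_range_succ, Function.update_self, Function.update_of_ne (by omega),
      ENNReal.ofReal_mul (G.transition_nonneg _ _), mul_assoc]
    congr 1
    refine Finset.prod_congr rfl fun i hi => ?_
    have := Finset.mem_range.1 hi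
    rw [Function.update_of_ne (by omega), Function.update_of_ne (by omega)]
  have hsum : HasSum (fun z => G.transition (w n) z * (1 - G.hitProb y N z))
      (1 - G.averaging (G.hitProb y N) (w n)) := by
    simp only [mul_sub, mul_one]
    exact (G.hasSum_transition (w n)).sub
      (summable_transition_mul (G.hitProb_nonneg y N) (G.hitProb_le_one y N) (w n)).hasSum
  -- The omitted summand `z = y` vanishes since `hitProb` equals `1` there.
  have hsum' : HasSum (fun z : {z : V // z ≠ y} => G.transition (w n) z * (1 - G.hitProb y N z))
      (1 - G.averaging (G.hitProb y N) (w n)) := by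
    refine (hasSum_subtype_iff_of_support_subset (s := {z | z ≠ y}) ?_).2 hsum
    intro z hz h
    exact hz (by simp [h])
  rw [← hsum'.tsum_eq, ENNReal.ofReal_tsum_of_nonneg (fun z => mul_nonneg (G.transition_nonneg _ _)
    (sub_nonneg.2 (G.hitProb_le_one _ _ _))) hsum'.summable, ← ENNReal.tsum_mul_left]
  exact (ENNReal.tsum_le_tsum hterm).trans ((tsum_meas_le_meas_iUnion_of_disjoint P
    (fun z => G.measurableSet_followAvoid _ _ _ _) hdisj).trans (measure_mono hsub))

variable {G} in
lemma IsMarkovLaw.followAvoid_bound {x : V} {P : Measure G.Trajectory} (hP : G.IsMarkovLaw x P)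
    (y : V) (N n : ℕ) (w : ℕ → V) (hw : w 0 = x) (hn : w n ≠ y) :
    (∏ i ∈ Finset.range n, ENNReal.ofReal (G.transition (w i) (w (i + 1)))) *
      ENNReal.ofReal (1 - G.hitProb y N (w n)) ≤ P (G.followAvoid y n N w) := by
  induction N generalizing n w with
  | zero =>
    have e : G.followAvoid y n 0 w = {Y | ∀ i ≤ n, Y i = w i} := by
      ext Y
      exact ⟨fun h => h.1, fun h => ⟨h, fun k h1 h2 => absurd h1 (by omega)⟩⟩
    rw [e, hP.cylinder n w hw]
    simp [hitProb, hn]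
  | succ N ih =>
    rw [G.hitProb_succ_of_ne hn]
    exact followAvoid_succ_bound ih n w hw

variable {G} in
-- Time `0` does not count here: averaging `hitProb y N` once gives the probability of a visit at
-- one of the times `1, …, N + 1`, also when `x = y`.
lemma IsMarkovLaw.le_measure_avoid {x : V} {P : Measure G.Trajectory} (hP : G.IsMarkovLaw x P)
    (y : V) (N : ℕ) : ENNReal.ofReal (1 - G.averaging (G.hitProb y N) x) ≤
      P {Y | ∀ k, 0 < k → k ≤ N + 1 → Y k ≠ y} := by
  have h := followAvoid_succ_bound (hP.followAvoid_bound y N) 0 (fun _ => x) rfl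
  rw [Finset.prod_range_zero, one_mul] at h
  refine h.trans (measure_mono fun Y hY k hk hk' => hY.2 k hk (by omega))

variable {G} in
-- The events of avoiding `y` up to time `N + 1` decrease to the event of never visiting `y`, which
-- is null, and their probabilities dominate `1 - averaging`.
lemma IsRecurrent.tendsto_averaging_hitProb (hG : G.IsRecurrent) (x y : V) :
    Tendsto (fun N => G.averaging (G.hitProb y N) x) atTop (𝓝 1) := by
  obtain ⟨P, hP, hPy⟩ := hG x y
  have := hP.isProbabilityMeasure
  set A : ℕ → Set G.Trajectory := fun N => {Y | ∀ k, 0 < k → k ≤ N + 1 → Y k ≠ y} with hA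
  have hAm : ∀ N, MeasurableSet (A N) := by
    intro N
    have e : A N = ⋂ k, ⋂ _ : 0 < k, ⋂ _ : k ≤ N + 1,
        {Y : G.Trajectory | Y k ∈ ({y}ᶜ : Set V)} := by
      ext Y
      simp [hA]
    rw [e]
    exact MeasurableSet.iInter fun i => MeasurableSet.iInter fun _ => MeasurableSet.iInter fun _ =>
      G.measurableSet_coord _ _
  have hanti : Antitone A := fun M N h Y hY k hk hk' => hY k hk (by omega)
  have hlim := tendsto_measure_iInter_atTop (μ := P) (fun N => (hAm N).nullMeasurableSet) hanti
    ⟨0, measure_ne_top _ _⟩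
  have hinter : ⋂ N, A N = {Y : G.Trajectory | ∃ k : ℕ, 0 < k ∧ Y k = y}ᶜ := by
    ext Y
    simp only [hA, Set.mem_iInter, Set.mem_ofPred_eq, Set.mem_compl_iff, not_exists, not_and]
    exact ⟨fun h k hk => h k k hk (by omega), fun h _ k hk _ => h k hk⟩
  have hm : MeasurableSet {Y : G.Trajectory | ∃ k : ℕ, 0 < k ∧ Y k = y} := by
    have e : {Y : G.Trajectory | ∃ k : ℕ, 0 < k ∧ Y k = y} =
        ⋃ k, ⋃ _ : 0 < k, {Y : G.Trajectory | Y k ∈ ({y} : Set V)} := by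
      ext Y
      simp
    rw [e]
    exact MeasurableSet.iUnion fun i => MeasurableSet.iUnion fun _ => G.measurableSet_coord _ _
  rw [hinter, (prob_compl_eq_zero_iff hm).2 hPy] at hlim
  have h1 := tendsto_of_tendsto_of_tendsto_of_le_of_le tendsto_const_nhds hlim
    (fun N => bot_le) (fun N => hP.le_measure_avoid y N)
  have h2 := (ENNReal.tendsto_toReal ENNReal.zero_ne_top).comp h1
  have h3 : Tendsto (fun N => 1 - G.averaging (G.hitProb y N) x) atTop (𝓝 0) := by
    refine h2.congr fun N => ?_
    simp only [Function.comp_apply]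
    exact ENNReal.toReal_ofReal (sub_nonneg.2
      (averaging_le_one (G.hitProb_nonneg y N) (G.hitProb_le_one y N) x))
  have h4 := h3.const_sub 1
  simpa using h4

variable {G} in
lemma IsRecurrent.tendsto_hitProb (hG : G.IsRecurrent) (x y : V) :
    Tendsto (fun N => G.hitProb y N x) atTop (𝓝 1) := by
  by_cases h : x = y
  · simp [h]
  · rw [← tendsto_add_atTop_iff_nat 1]
    simp only [G.hitProb_succ_of_ne h]
    exact hG.tendsto_averaging_hitProb x y

end WeightedGraph

lemma HasSum.of_eq {ι E : Type*} [AddCommMonoid E] [TopologicalSpace E] {f g : ι → E} {a c : E}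
    (h : HasSum f a) (hfg : ∀ i, g i = f i) (hac : c = a) : HasSum g c := by
  rw [funext hfg, hac]
  exact h

namespace WeightedGraph

variable {V : Type*} (G : WeightedGraph V)

/-! ### The energy of hitting probabilities and flows on recurrent graphs -/

variable {G} in
lemma summable_prod_fst {f : V → ℝ} (h0 : ∀ x, 0 ≤ f x)
    (hf : Summable fun x => (∑' z, G.b x z) * f x) :
    Summable fun p : V × V => G.b p.1 p.2 * f p.1 := by
  have hnn : 0 ≤ fun p : V × V => G.b p.1 p.2 * f p.1 :=
    fun p => mul_nonneg (G.nonneg p.1 p.2) (h0 p.1)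
  refine (summable_prod_of_nonneg hnn).2 ⟨fun x => (G.summable x).mul_right (f x), ?_⟩
  exact hf.congr fun x => tsum_mul_right.symm

variable {G} in
lemma summable_prod_snd {f : V → ℝ} (h0 : ∀ x, 0 ≤ f x)
    (hf : Summable fun x => (∑' z, G.b x z) * f x) :
    Summable fun p : V × V => G.b p.1 p.2 * f p.2 := by
  refine ((Equiv.prodComm V V).summable_iff.2 (summable_prod_fst h0 hf)).congr fun p => ?_
  simp [G.symm p.1 p.2]

lemma tsum_b_mul_averaging (f : V → ℝ) (x : V) :
    (∑' z, G.b x z) * G.averaging f x = ∑' z, G.b x z * f z := by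
  rw [averaging, ← tsum_mul_left]
  refine tsum_congr fun z => ?_
  rw [← mul_assoc, G.tsum_b_mul_transition]

/-- Replaces finite support of `hitProb`, which can fail on graphs that are not locally finite. One
has `h_{N+1} ≤ 1_y + P h_N`, and by symmetry of `b` the transition operator `P` preserves
summability against the vertex degrees. -/
lemma summable_tsum_b_mul_hitProb (y : V) (N : ℕ) :
    Summable fun x => (∑' z, G.b x z) * G.hitProb y N x := by
  classical
  have hfin : Summable fun x => (∑' z, G.b x z) * if x = y then (1 : ℝ) else 0 :=
    summable_of_hasFiniteSupport ((Set.finite_singleton y).subset fun x hx => by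
      by_contra h
      exact hx (by simp [show x ≠ y from h]))
  induction N with
  | zero => simpa only [hitProb] using hfin
  | succ N ih =>
    have h2 := (summable_prod_snd (G.hitProb_nonneg y N) ih).prod
    refine Summable.of_nonneg_of_le
      (fun x => mul_nonneg (G.tsum_b_nonneg x) (G.hitProb_nonneg _ _ _)) (fun x => ?_)
      (hfin.add h2)
    dsimp only
    rw [← G.tsum_b_mul_averaging]
    have h3 := mul_nonneg (G.tsum_b_nonneg x) (averaging_nonneg (G := G) (G.hitProb_nonneg y N) x)
    by_cases h : x = y
    · simpa [h] using h ▸ h3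
    · simp [h, G.hitProb_succ_of_ne h]

lemma summable_tsum_b_mul_hitProb_sq (y : V) (N : ℕ) :
    Summable fun x => (∑' z, G.b x z) * G.hitProb y N x ^ 2 :=
  Summable.of_nonneg_of_le (fun x => mul_nonneg (G.tsum_b_nonneg x) (sq_nonneg _))
    (fun x => mul_le_mul_of_nonneg_left (pow_le_of_le_one (G.hitProb_nonneg y N x)
      (G.hitProb_le_one y N x) two_ne_zero) (G.tsum_b_nonneg x))
    (G.summable_tsum_b_mul_hitProb y N)

/-- Green's formula, by expanding the square; each of the three resulting double series converges
absolutely. Ordered pairs count every edge twice, whence the factor `2`. -/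
lemma hasSum_energy_hitProb (y : V) (N : ℕ) :
    HasSum (fun p : V × V => G.b p.1 p.2 * (G.hitProb y N p.1 - G.hitProb y N p.2) ^ 2)
      (2 * ∑' x, (∑' z, G.b x z) * G.hitProb y N x *
        (G.hitProb y N x - G.averaging (G.hitProb y N) x)) := by
  set h := G.hitProb y N
  have h0 := G.hitProb_nonneg y N
  have h1 := G.hitProb_le_one y N
  have hl := G.summable_tsum_b_mul_hitProb y N
  have hq := G.summable_tsum_b_mul_hitProb_sq y N
  have s1 := summable_prod_fst (fun x => sq_nonneg (h x)) hq
  have s2 := summable_prod_snd (fun x => sq_nonneg (h x)) hq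
  have s3 : Summable fun p : V × V => h p.1 * (G.b p.1 p.2 * h p.2) :=
    Summable.of_nonneg_of_le (fun p => mul_nonneg (h0 _) (mul_nonneg (G.nonneg _ _) (h0 _)))
      (fun p => mul_le_of_le_one_left (mul_nonneg (G.nonneg _ _) (h0 _)) (h1 _))
      (summable_prod_snd h0 hl)
  have e1 : ∑' p : V × V, G.b p.1 p.2 * h p.1 ^ 2 = ∑' x, (∑' z, G.b x z) * h x ^ 2 := by
    rw [s1.tsum_prod]
    simp only [tsum_mul_right]
  have e2 : ∑' p : V × V, G.b p.1 p.2 * h p.2 ^ 2 = ∑' x, (∑' z, G.b x z) * h x ^ 2 := by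
    rw [← e1, ← (Equiv.prodComm V V).tsum_eq]
    refine tsum_congr fun p => ?_
    simp [G.symm p.1 p.2]
  have e3 : ∑' p : V × V, h p.1 * (G.b p.1 p.2 * h p.2) =
      ∑' x, (∑' z, G.b x z) * h x * G.averaging h x := by
    rw [s3.tsum_prod]
    refine tsum_congr fun x => ?_
    dsimp only
    rw [tsum_mul_left, ← G.tsum_b_mul_averaging]
    ring
  have s3' : Summable fun x => (∑' z, G.b x z) * h x * G.averaging h x := by
    refine s3.prod.congr fun x => ?_
    dsimp only
    rw [tsum_mul_left, ← G.tsum_b_mul_averaging]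
    ring
  have key := (s1.hasSum.add s2.hasSum).sub (s3.hasSum.mul_left 2)
  rw [e1, e2, e3] at key
  refine key.of_eq (fun p => by ring) ?_
  · rw [← two_mul, ← mul_sub, ← hq.tsum_sub s3']
    congr 1
    refine tsum_congr fun x => ?_
    ring

/-- Away from `y`, `h_N - P h_N = h_N - h_{N+1} ≤ 0`, so in Green's formula only the term at `y` can
be positive. Its factor `1 - P h_N(y)` bounds the probability of no return within `N + 1` steps and
tends to zero by recurrence. -/
lemma energy_hitProb_le (y : V) (N : ℕ) :
    ∑' p : V × V, G.b p.1 p.2 * (G.hitProb y N p.1 - G.hitProb y N p.2) ^ 2 ≤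
      2 * ((∑' z, G.b y z) * (1 - G.averaging (G.hitProb y N) y)) := by
  classical
  rw [(G.hasSum_energy_hitProb y N).tsum_eq]
  refine mul_le_mul_of_nonneg_left ?_ zero_le_two
  have h0 := G.hitProb_nonneg y N
  have h1 := G.hitProb_le_one y N
  have hs : Summable fun x => (∑' z, G.b x z) * G.hitProb y N x *
      (G.hitProb y N x - G.averaging (G.hitProb y N) x) := by
    refine Summable.of_norm_bounded (G.summable_tsum_b_mul_hitProb y N) fun x => ?_
    have h2 := averaging_nonneg (G := G) h0 x
    have h3 := averaging_le_one (G := G) h0 h1 x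
    rw [norm_mul, Real.norm_of_nonneg (mul_nonneg (G.tsum_b_nonneg x) (h0 x))]
    refine mul_le_of_le_one_right (mul_nonneg (G.tsum_b_nonneg x) (h0 x)) ?_
    rw [Real.norm_eq_abs, abs_le]
    constructor <;> linarith [h0 x, h1 x]
  refine hasSum_le (fun x => ?_) hs.hasSum (hasSum_ite_eq y _)
  split_ifs with h
  · subst h
    simp
  · refine mul_nonpos_of_nonneg_of_nonpos (mul_nonneg (G.tsum_b_nonneg x) (h0 x)) ?_
    rw [← G.hitProb_succ_of_ne h]
    exact sub_nonpos.2 (G.hitProb_le_succ y N x)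

/-- On a recurrent graph, a flow of finite energy with absolutely summable divergence has total
divergence zero. -/
theorem IsRecurrent.tsum_divergence_eq_zero {G : WeightedGraph V} (hG : G.IsRecurrent)
    (φ : V → V → ℂ) (hanti : ∀ x z, (G.b x z : ℂ) * φ z x = -(G.b x z * φ x z))
    (hE : Summable fun p : V × V => G.b p.1 p.2 * ‖φ p.1 p.2‖ ^ 2)
    (hD : Summable fun x => ∑' z, (G.b x z : ℂ) * φ x z) :
    ∑' x, ∑' z, (G.b x z : ℂ) * φ x z = 0 := by
  rcases isEmpty_or_nonempty V with hV | ⟨⟨y⟩⟩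
  · simp
  set D : V → ℂ := fun x => ∑' z, (G.b x z : ℂ) * φ x z
  set E := ∑' p : V × V, G.b p.1 p.2 * ‖φ p.1 p.2‖ ^ 2
  set h := G.hitProb y
  set Q : ℕ → ℝ := fun N => ∑' p : V × V, G.b p.1 p.2 * (h N p.1 - h N p.2) ^ 2
  have hnorm : ∀ (x z : V) (c : ℝ), ‖(c : ℂ) * ((G.b x z : ℂ) * φ x z)‖ =
      |c| * (G.b x z * ‖φ x z‖) := by
    intro x z c
    rw [norm_mul, norm_mul, Complex.norm_real, Complex.norm_real,
      Real.norm_of_nonneg (G.nonneg x z), Real.norm_eq_abs]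
  -- Young's inequality with a free `ε` takes the place of Cauchy–Schwarz for the double sum.
  have hyoung : ∀ (x z : V) (c ε : ℝ), 0 < ε → |c| * (G.b x z * ‖φ x z‖) ≤
      (ε / 2) * (G.b x z * ‖φ x z‖ ^ 2) + (1 / (2 * ε)) * (G.b x z * c ^ 2) := by
    intro x z c ε hε
    have h1 : |c| * ‖φ x z‖ ≤ (ε / 2) * ‖φ x z‖ ^ 2 + (1 / (2 * ε)) * c ^ 2 := by
      rw [← sub_nonneg, ← sq_abs c]
      have : (ε / 2) * ‖φ x z‖ ^ 2 + (1 / (2 * ε)) * |c| ^ 2 - |c| * ‖φ x z‖ =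
          (1 / (2 * ε)) * (ε * ‖φ x z‖ - |c|) ^ 2 := by
        field_simp
        ring
      rw [this]
      positivity
    nlinarith [mul_le_mul_of_nonneg_left h1 (G.nonneg x z)]
  have hTs : ∀ N, Summable fun p : V × V => (h N p.1 : ℂ) * ((G.b p.1 p.2 : ℂ) * φ p.1 p.2) := by
    intro N
    refine Summable.of_norm_bounded ((hE.mul_left (1 / 2)).add
      ((summable_prod_fst (fun x => sq_nonneg (h N x))
        (G.summable_tsum_b_mul_hitProb_sq y N)).mul_left (1 / (2 * 1)))) fun p => ?_
    rw [hnorm]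
    exact hyoung _ _ _ 1 one_pos
  set T : ℕ → ℂ := fun N => ∑' x, (h N x : ℂ) * D x
  have hTeq : ∀ N, T N = ∑' p : V × V, (h N p.1 : ℂ) * ((G.b p.1 p.2 : ℂ) * φ p.1 p.2) := by
    intro N
    rw [(hTs N).tsum_prod]
    exact tsum_congr fun x => tsum_mul_left.symm
  have hTs' : ∀ N, HasSum (fun p : V × V => (h N p.2 : ℂ) * ((G.b p.1 p.2 : ℂ) * φ p.1 p.2))
      (-T N) := by
    intro N
    have h1 := ((Equiv.prodComm V V).hasSum_iff.2 ((hTeq N) ▸ (hTs N).hasSum)).neg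
    refine h1.of_eq (fun p => ?_) rfl
    simp only [Function.comp_apply, Equiv.prodComm_apply, Prod.fst_swap, Prod.snd_swap]
    rw [G.symm p.2 p.1, hanti, mul_neg, neg_neg]
  -- Antisymmetry of the flow makes `2 T N` the pairing of the flow with the gradient of `h N`.
  have hbound : ∀ N (ε : ℝ), 0 < ε → 2 * ‖T N‖ ≤ (ε / 2) * E + (1 / (2 * ε)) * Q N := by
    intro N ε hε
    have h1 : HasSum (fun p : V × V => ((h N p.1 - h N p.2 : ℝ) : ℂ) *
        ((G.b p.1 p.2 : ℂ) * φ p.1 p.2)) (2 * T N) := by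
      have := ((hTeq N) ▸ (hTs N).hasSum).sub (hTs' N)
      exact this.of_eq (fun p => by push_cast; ring) (by ring)
    have h2 := (hE.hasSum.mul_left (ε / 2)).add
      ((G.hasSum_energy_hitProb y N).summable.hasSum.mul_left (1 / (2 * ε)))
    have h3 : ‖2 * T N‖ ≤ (ε / 2) * E + (1 / (2 * ε)) * Q N := by
      refine h1.norm_le_of_bounded h2 fun p => ?_
      rw [hnorm]
      exact hyoung _ _ _ ε hε
    rwa [norm_mul, Complex.norm_ofNat] at h3
  have hTlim : Tendsto T atTop (𝓝 (∑' x, D x)) := by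
    refine tendsto_tsum_of_dominated_convergence (bound := fun x => ‖D x‖) hD.norm (fun x => ?_)
      (Eventually.of_forall fun N x => ?_)
    · have h1 := (hG.tendsto_hitProb x y).ofReal.mul_const (D x)
      simpa using h1
    · rw [norm_mul, Complex.norm_real, Real.norm_of_nonneg (G.hitProb_nonneg y N x)]
      exact mul_le_of_le_one_left (norm_nonneg _) (G.hitProb_le_one y N x)
  have hQlim : Tendsto Q atTop (𝓝 0) := by
    have h1 := (((hG.tendsto_averaging_hitProb y y).const_sub 1).const_mul
      (∑' z, G.b y z)).const_mul 2
    rw [sub_self, mul_zero, mul_zero] at h1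
    exact tendsto_of_tendsto_of_tendsto_of_le_of_le tendsto_const_nhds h1
      (fun N => tsum_nonneg fun p => mul_nonneg (G.nonneg _ _) (sq_nonneg _))
      (fun N => G.energy_hitProb_le y N)
  -- The limit `N → ∞` is taken at fixed `ε`, which removes the term with `1 / ε`; only then `ε →
  -- 0`.
  have hle : ∀ ε : ℝ, 0 < ε → 2 * ‖∑' x, D x‖ ≤ (ε / 2) * E := by
    intro ε hε
    have h1 := ((hQlim.const_mul (1 / (2 * ε))).const_add ((ε / 2) * E))
    rw [mul_zero, add_zero] at h1
    exact le_of_tendsto_of_tendsto' (hTlim.norm.const_mul 2) h1 fun N => hbound N ε hε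
  have h1 : Tendsto (fun ε : ℝ => (ε / 2) * E) (𝓝[>] 0) (𝓝 0) := by
    have : Tendsto (fun ε : ℝ => (ε / 2) * E) (𝓝 0) (𝓝 ((0 / 2) * E)) :=
      (Continuous.tendsto (by fun_prop) 0)
    rw [zero_div, zero_mul] at this
    exact this.mono_left nhdsWithin_le_nhds
  have h2 : 2 * ‖∑' x, D x‖ ≤ 0 :=
    ge_of_tendsto h1 (eventually_nhdsWithin_of_forall fun ε hε => hle ε hε)
  exact norm_le_zero_iff.1 (by linarith)

end WeightedGraph

/-! ### From recurrent graphs to graphs with recurrent components. -/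

namespace WeightedGraph

variable {V : Type*} (G : WeightedGraph V)

/-- If all connected components of a graph are recurrent, then a flow of finite energy with
absolutely summable divergence has total divergence zero. -/
theorem tsum_divergence_eq_zero_of_components
    (hG : ∀ c : G.toSimpleGraph.ConnectedComponent, (G.induce c.supp).IsRecurrent)
    (φ : V → V → ℂ) (hanti : ∀ x z, (G.b x z : ℂ) * φ z x = -(G.b x z * φ x z))
    (hE : Summable fun p : V × V => G.b p.1 p.2 * ‖φ p.1 p.2‖ ^ 2)
    (hD : Summable fun x => ∑' z, (G.b x z : ℂ) * φ x z) :
    ∑' x, ∑' z, (G.b x z : ℂ) * φ x z = 0 := by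
  set e := Equiv.sigmaFiberEquiv G.toSimpleGraph.connectedComponentMk
  -- No edge leaves a component, so the divergence at a vertex may be computed inside its component.
  have hrow : ∀ (c : G.toSimpleGraph.ConnectedComponent) (x : c.supp),
      ∑' z, (G.b x z : ℂ) * φ x z = ∑' z : c.supp, (((G.induce c.supp).b x z : ℝ) : ℂ) * φ x z := by
    intro c x
    refine (tsum_subtype_eq_of_support_subset (s := c.supp)
      (f := fun z => (G.b x z : ℂ) * φ x z) ?_).symm
    intro z hz
    have hb : G.b x z ≠ 0 := fun h => hz (by simp [h])
    have hadj : G.toSimpleGraph.Adj x z := lt_of_le_of_ne (G.nonneg _ _) hb.symm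
    exact (SimpleGraph.ConnectedComponent.mem_supp_congr_adj c hadj).1 x.2
  refine ((e.tsum_eq _).symm.trans (e.summable_iff.2 hD).tsum_sigma).trans ?_
  refine (tsum_congr fun c => ?_).trans tsum_zero
  have h := (hG c).tsum_divergence_eq_zero (fun x z => φ x z) (fun x z => hanti x z)
    (hE.comp_injective (i := fun p : c.supp × c.supp => ((p.1 : V), (p.2 : V)))
      (Subtype.val_injective.prodMap Subtype.val_injective))
    ((hD.subtype c.supp).congr fun x => hrow c x)
  rw [← h]
  exact tsum_congr fun x => hrow c x

end WeightedGraph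

namespace WeightedComplex

variable {X : Type*} (K : WeightedComplex X)

/-! ### `ℓ²(Σ, m)` as a space of functions -/

open ComplexConjugate in
lemma hasSum_inner (f g : K.L2) :
    HasSum (fun τ => (K.m τ : ℂ) * (conj (K.toFun f τ) * K.toFun g τ)) (inner ℂ f g) := by
  have hi : Integrable (fun a => inner ℂ (f a) (g a))
    (Measure.sum fun τ : K.Simplex => ENNReal.ofReal (K.m τ) • Measure.dirac τ) :=
    L2.integrable_inner (𝕜 := ℂ) f g
  have h := hasSum_integral_measure hi
  rw [L2.inner_def]
  refine h.of_eq (fun τ => ?_) rfl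
  have : MeasurableSingletonClass K.Simplex := ⟨fun _ => MeasurableSpace.measurableSet_top⟩
  rw [integral_smul_measure, integral_dirac, ENNReal.toReal_ofReal (m_pos τ).le,
    RCLike.inner_apply', Complex.real_smul]
  rfl

lemma hasSum_norm_sq (f : K.L2) : HasSum (fun τ => K.m τ * ‖K.toFun f τ‖ ^ 2) (‖f‖ ^ 2) := by
  have h := K.hasSum_inner f f
  rw [inner_self_eq_norm_sq_to_K] at h
  refine (Complex.hasSum_re h).of_eq (fun τ => ?_) ?_
  · rw [Complex.conj_mul', ← Complex.ofReal_pow, ← Complex.ofReal_mul, Complex.ofReal_re]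
  · exact (Complex.ofReal_re (‖f‖ ^ 2)).symm.trans (congrArg Complex.re (Complex.ofReal_pow _ _))

lemma sqNorm_toFun (f : K.L2) : K.sqNorm (K.toFun f) = ENNReal.ofReal (‖f‖ ^ 2) := by
  rw [← (K.hasSum_norm_sq f).tsum_eq, ENNReal.ofReal_tsum_of_nonneg
    (fun τ => mul_nonneg (m_pos τ).le (sq_nonneg _)) (K.hasSum_norm_sq f).summable]
  rfl

lemma exists_toFun_eq {ω : K.Simplex → ℂ} (h : Summable fun τ => K.m τ * ‖ω τ‖ ^ 2) :
    ∃ f : K.L2, K.toFun f = ω := by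
  have : MeasurableSingletonClass K.Simplex := ⟨fun _ => MeasurableSpace.measurableSet_top⟩
  have hm : AEStronglyMeasurable ω K.measure :=
    (measurable_from_top (f := ω)).aestronglyMeasurable
  have hl : MemLp ω 2 K.measure := by
    refine ⟨hm, (eLpNorm_lt_top_iff_lintegral_rpow_enorm_lt_top (by simp) (by simp)).2 ?_⟩
    rw [measure, lintegral_sum_measure]
    have e : ∀ τ, ∫⁻ a, ‖ω a‖ₑ ^ (2 : ℝ≥0∞).toReal ∂(ENNReal.ofReal (K.m τ) • Measure.dirac τ) =
        ENNReal.ofReal (K.m τ * ‖ω τ‖ ^ 2) := by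
      intro τ
      rw [lintegral_smul_measure, lintegral_dirac, ENNReal.ofReal_mul (m_pos τ).le,
        ENNReal.ofReal_pow (norm_nonneg _), ofReal_norm, smul_eq_mul]
      norm_num
    rw [tsum_congr e, ← ENNReal.ofReal_tsum_of_nonneg
      (fun τ => mul_nonneg (m_pos τ).le (sq_nonneg _)) h]
    exact ENNReal.ofReal_lt_top
  exact ⟨hl.toLp ω, funext (K.ae_iff.1 hl.coeFn_toLp)⟩

lemma exists_single (τ : K.Simplex) : ∃ f : K.L2, K.toFun f = Set.indicator {τ} 1 :=
  K.exists_toFun_eq (summable_of_hasFiniteSupport ((Set.finite_singleton τ).subset fun σ hσ => by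
    by_contra h
    exact hσ (by simp [Set.indicator_of_notMem h])))

/-- The indicator function of a simplex as an element of `ℓ²(Σ, m)`. -/
def single (τ : K.Simplex) : K.L2 := (K.exists_single τ).choose

@[simp] lemma toFun_single (τ : K.Simplex) : K.toFun (K.single τ) = Set.indicator {τ} 1 :=
  (K.exists_single τ).choose_spec

/-- Makes point evaluations continuous on `ℓ²`, from which the closedness of `level k` and the
closedness of `δ` follow. -/
lemma inner_single (τ : K.Simplex) (f : K.L2) :
    inner ℂ (K.single τ) f = (K.m τ : ℂ) * K.toFun f τ := by
  rw [← (K.hasSum_inner _ f).tsum_eq, tsum_eq_single τ]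
  · simp
  · intro σ hσ
    simp [Set.indicator_of_notMem (s := {τ}) (a := σ) hσ]

lemma continuous_toFun_apply (τ : K.Simplex) : Continuous fun f : K.L2 => K.toFun f τ := by
  have e : (fun f : K.L2 => K.toFun f τ) = fun f => (K.m τ : ℂ)⁻¹ * inner ℂ (K.single τ) f := by
    funext f
    rw [inner_single, inv_mul_cancel_left₀ (Complex.ofReal_ne_zero.2 (m_pos τ).ne')]
  rw [e]
  exact continuous_const.mul (continuous_const.inner continuous_id)

lemma isClosed_level (k : ℤ) : IsClosed (K.level k : Set K.L2) := by
  have e : (K.level k : Set K.L2) =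
      ⋂ τ : K.Simplex, ⋂ _ : (τ.1.card : ℤ) ≠ k + 1, {f : K.L2 | K.toFun f τ = 0} := by
    ext f
    simp only [SetLike.mem_coe, Set.mem_iInter, Set.mem_ofPred_eq]
    exact ⟨fun h τ hτ => by_contra fun h0 => hτ (h τ h0), fun h τ h0 => by_contra fun hτ =>
      h0 (h τ hτ)⟩
  rw [e]
  exact isClosed_iInter fun τ => isClosed_iInter fun _ =>
    isClosed_eq (K.continuous_toFun_apply τ) continuous_const

lemma eq_sum_smul_indicator {u : K.Simplex → ℂ} (hu : (Function.support u).Finite) :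
    u = ∑ τ ∈ hu.toFinset, u τ • (Set.indicator {τ} 1 : K.Simplex → ℂ) := by
  classical
  funext σ
  rw [Finset.sum_apply]
  by_cases h : u σ = 0
  · rw [h]
    refine (Finset.sum_eq_zero fun τ hτ => ?_).symm
    have hne : σ ≠ τ := fun e => (hu.mem_toFinset.1 hτ) (e ▸ h)
    rw [Pi.smul_apply, Set.indicator_of_notMem (s := {τ}) (a := σ) hne, smul_zero]
  · rw [Finset.sum_eq_single σ]
    · simp
    · intro τ _ hne
      rw [Pi.smul_apply, Set.indicator_of_notMem (s := {τ}) (a := σ) hne.symm, smul_zero]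
    · intro h'
      exact absurd (hu.mem_toFinset.2 h) h'

/-! ### Faces -/

lemma summable_coface (τ : K.Simplex) :
    Summable fun σ : {σ : K.Simplex // IsFace τ.1 σ.1} => K.m σ.1 := by
  let f : {σ : K.Simplex // IsFace τ.1 σ.1} → {σ : Finset X // σ ∈ K.faces ∧ IsFace τ.1 σ} :=
    fun σ => ⟨σ.1.1, σ.1.2.1, σ.2⟩
  have hf : Function.Injective f := by
    intro a c h
    exact Subtype.ext (Subtype.ext (congrArg (fun x => x.1) h))
  exact (K.locally_summable τ.1 τ.2).comp_injective hf

lemma finite_faces (σ : K.Simplex) : Finite {τ : K.Simplex // IsFace τ.1 σ.1} := by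
  refine Finite.of_injective (β := σ.1.powerset)
    (fun τ => ⟨τ.1.1, Finset.mem_powerset.2 τ.2.1⟩) fun a c h => ?_
  exact Subtype.ext (Subtype.ext (congrArg (fun x => x.1) h))

variable {K}

/-- From `|t| ≤ 1 + |t|²`: local summability of `m` handles the `1`, membership in `ℓ²` the square.
Hence all of `ℓ²` lies in the domain of `∂`. -/
lemma summable_coface_mul_norm (f : K.L2) (ρ : K.Simplex) :
    Summable fun τ : {τ : K.Simplex // IsFace ρ.1 τ.1} => K.m τ.1 * ‖K.toFun f τ.1‖ := by
  refine Summable.of_nonneg_of_le (fun τ => mul_nonneg (m_pos τ.1).le (norm_nonneg _))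
    (fun τ => ?_) ((K.summable_coface ρ).add
      ((K.hasSum_norm_sq f).summable.subtype {τ : K.Simplex | IsFace ρ.1 τ.1}))
  have h1 : ‖K.toFun f τ.1‖ ≤ 1 + ‖K.toFun f τ.1‖ ^ 2 := by
    nlinarith [sq_nonneg (‖K.toFun f τ.1‖ - 1), norm_nonneg (K.toFun f τ.1)]
  have := mul_le_mul_of_nonneg_left h1 (m_pos τ.1).le
  rw [mul_add, mul_one] at this
  exact this

/-! ### The boundary operator as formal adjoint of the coboundary operator. -/

namespace Coboundary

variable (d : K.Coboundary)

lemma mem_boundary_domain (f : K.L2) : K.toFun f ∈ d.boundary.domain :=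
  fun ρ => summable_coface_mul_norm f ρ

lemma θ_eq_zero {τ σ : K.Simplex} (h : ¬ IsFace τ.1 σ.1) : d.θ τ σ = 0 :=
  by_contra fun h' => h ((d.ne_zero_iff τ σ).1 h')

lemma norm_θ {τ σ : K.Simplex} (h : IsFace τ.1 σ.1) : ‖d.θ τ σ‖ = 1 := by
  have h0 : d.θ τ σ ≠ 0 := (d.ne_zero_iff τ σ).2 h
  have h1 : d.θ τ σ ∈ ({1, -1, 0} : Set ℂ) := d.mem_signs τ σ
  simp only [Set.mem_insert_iff, Set.mem_singleton_iff] at h1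
  rcases h1 with h1 | h1 | h1
  · simp [h1]
  · simp [h1]
  · exact absurd h1 h0

open ComplexConjugate in
lemma conj_θ (τ σ : K.Simplex) : conj (d.θ τ σ) = d.θ τ σ := by
  have h1 : d.θ τ σ ∈ ({1, -1, 0} : Set ℂ) := d.mem_signs τ σ
  simp only [Set.mem_insert_iff, Set.mem_singleton_iff] at h1
  rcases h1 with h1 | h1 | h1 <;> simp [h1]

/-- Since `|θ(τ, ·)|` is the indicator of the cofaces of `τ`, this is local summability of `m`. -/
lemma exists_δ_single (τ : K.Simplex) : ∃ f : K.L2, K.toFun f = d.θ τ := by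
  refine K.exists_toFun_eq ?_
  have h := (summable_subtype_iff_indicator (s := {σ : K.Simplex | IsFace τ.1 σ.1})
    (f := K.m)).1 (K.summable_coface τ)
  refine h.congr fun σ => ?_
  by_cases hσ : IsFace τ.1 σ.1
  · rw [d.norm_θ hσ, Set.indicator_of_mem (s := {σ : K.Simplex | IsFace τ.1 σ.1}) hσ]
    simp
  · rw [d.θ_eq_zero hσ, Set.indicator_of_notMem (s := {σ : K.Simplex | IsFace τ.1 σ.1}) hσ]
    simp

/-- The coboundary `δ 1_τ` of the indicator function of `τ` as an element of `ℓ²(Σ, m)`. -/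
def δSingle (τ : K.Simplex) : K.L2 := (d.exists_δ_single τ).choose

@[simp] lemma toFun_δSingle (τ : K.Simplex) : K.toFun (d.δSingle τ) = d.θ τ :=
  (d.exists_δ_single τ).choose_spec

lemma inner_δSingle (τ : K.Simplex) (f : K.L2) : inner ℂ (d.δSingle τ) f =
    ∑' σ : {σ : K.Simplex // IsFace τ.1 σ.1}, (K.m σ.1 : ℂ) * d.θ τ σ.1 * K.toFun f σ.1 := by
  rw [← (K.hasSum_inner _ f).tsum_eq]
  refine Eq.trans ?_ (tsum_subtype_eq_of_support_subset (s := {σ : K.Simplex | IsFace τ.1 σ.1})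
    (f := fun σ => (K.m σ : ℂ) * d.θ τ σ * K.toFun f σ) ?_).symm
  · refine tsum_congr fun σ => ?_
    rw [toFun_δSingle, conj_θ, mul_assoc]
  · intro σ hσ
    by_contra h
    exact hσ (by simp [d.θ_eq_zero h])

lemma inner_δSingle_eq_boundary (τ : K.Simplex) (f : K.L2) : inner ℂ (d.δSingle τ) f =
    (K.m τ : ℂ) * d.boundary ⟨K.toFun f, d.mem_boundary_domain f⟩ τ := by
  rw [inner_δSingle]
  exact (mul_inv_cancel_left₀ (Complex.ofReal_ne_zero.2 (m_pos τ).ne') _).symm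

/-- Exhibits `∂_N` as the adjoint of `δ` restricted to the span of the indicators `1_τ`. -/
lemma mem_graph_boundaryN_iff (f g : K.L2) : (f, g) ∈ d.boundaryN.graph ↔
    ∀ τ, inner ℂ (d.δSingle τ) f = inner ℂ (K.single τ) g := by
  have h0 : ∀ τ, (K.m τ : ℂ) ≠ 0 := fun τ => Complex.ofReal_ne_zero.2 (m_pos τ).ne'
  rw [boundaryN, mem_graph_maximal]
  simp only [inner_δSingle_eq_boundary, inner_single]
  constructor
  · rintro ⟨_, h⟩ τ
    rw [h]
  · intro h
    exact ⟨d.mem_boundary_domain f, funext fun τ => mul_left_cancel₀ (h0 τ) (h τ)⟩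

lemma mem_graph_coboundaryN_iff (f g : K.L2) :
    (f, g) ∈ d.coboundaryN.graph ↔ d.δ (K.toFun f) = K.toFun g := by
  rw [coboundaryN, mem_graph_maximal]
  exact ⟨fun ⟨_, h⟩ => h, fun h => ⟨trivial, h⟩⟩

end Coboundary

end WeightedComplex

lemma LinearPMap.mem_graph_domRestrict {R E F : Type*} [Ring R] [AddCommGroup E] [Module R E]
    [AddCommGroup F] [Module R F] (f : E →ₗ.[R] F) (S : Submodule R E) (x : E) (y : F) :
    (x, y) ∈ (f.domRestrict S).graph ↔ x ∈ S ∧ (x, y) ∈ f.graph := by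
  simp only [LinearPMap.mem_graph_iff]
  constructor
  · rintro ⟨z, rfl, rfl⟩
    exact ⟨z.2.1, ⟨z.1, z.2.2⟩, rfl, (LinearPMap.domRestrict_apply rfl).symm⟩
  · rintro ⟨hx, z, rfl, rfl⟩
    exact ⟨⟨z.1, hx, z.2⟩, rfl, LinearPMap.domRestrict_apply rfl⟩

/-! ### Mutual adjointness of `δ_D` and `∂_N`. -/

namespace WeightedComplex.Coboundary

variable {X : Type*} {K : WeightedComplex X} (d : K.Coboundary)

lemma mem_graph_coboundaryD_iff (f g : K.L2) : (f, g) ∈ d.coboundaryD.graph ↔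
    f ∈ d.dirichletDomain ∧ d.δ (K.toFun f) = K.toFun g := by
  rw [coboundaryD, LinearPMap.mem_graph_domRestrict, mem_graph_coboundaryN_iff]

lemma continuous_δ_apply (σ : K.Simplex) : Continuous fun f : K.L2 => d.δ (K.toFun f) σ := by
  have := K.finite_faces σ
  have := Fintype.ofFinite {τ : K.Simplex // IsFace τ.1 σ.1}
  have e : (fun f : K.L2 => d.δ (K.toFun f) σ) = fun f =>
      ∑ τ : {τ : K.Simplex // IsFace τ.1 σ.1}, d.δ (Set.indicator {τ.1} 1) σ * K.toFun f τ.1 := by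
    funext f
    rw [d.apply_eq, finsum_eq_sum_of_fintype]
  rw [e]
  exact continuous_finsetSum _ fun τ _ => continuous_const.mul (K.continuous_toFun_apply τ.1)

/-- The graph of the coboundary operator on finitely supported functions. -/
def finiteGraph : Submodule ℂ (WithLp 2 (K.L2 × K.L2)) :=
  Submodule.span ℂ (Set.range fun τ => WithLp.toLp 2 (K.single τ, d.δSingle τ))

lemma exists_mem_finiteGraph {u : K.Simplex → ℂ} (hu : (Function.support u).Finite) :
    ∃ p ∈ d.finiteGraph, K.toFun p.fst = u ∧ K.toFun p.snd = d.δ u := by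
  refine ⟨∑ τ ∈ hu.toFinset, u τ • WithLp.toLp 2 (K.single τ, d.δSingle τ),
    Submodule.sum_mem _ fun τ _ => Submodule.smul_mem _ _ (Submodule.subset_span ⟨τ, rfl⟩), ?_, ?_⟩
  · have e : (∑ τ ∈ hu.toFinset, u τ • WithLp.toLp 2 (K.single τ, d.δSingle τ)).fst =
        ∑ τ ∈ hu.toFinset, u τ • K.single τ :=
      map_sum (WithLp.fstL 2 ℂ K.L2 K.L2) _ _
    rw [e, map_sum]
    simp only [map_smul, toFun_single]
    exact (K.eq_sum_smul_indicator hu).symm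
  · have e : (∑ τ ∈ hu.toFinset, u τ • WithLp.toLp 2 (K.single τ, d.δSingle τ)).snd =
        ∑ τ ∈ hu.toFinset, u τ • d.δSingle τ :=
      map_sum (WithLp.sndL 2 ℂ K.L2 K.L2) _ _
    rw [e, map_sum]
    conv_rhs => rw [K.eq_sum_smul_indicator hu, map_sum]
    simp only [map_smul, toFun_δSingle]
    rfl

lemma exists_of_mem_finiteGraph {p : WithLp 2 (K.L2 × K.L2)} (hp : p ∈ d.finiteGraph) :
    (Function.support (K.toFun p.fst)).Finite ∧ d.δ (K.toFun p.fst) = K.toFun p.snd := by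
  induction hp using Submodule.span_induction with
  | mem x h =>
    obtain ⟨τ, rfl⟩ := h
    change (Function.support (K.toFun (K.single τ))).Finite ∧
      d.δ (K.toFun (K.single τ)) = K.toFun (d.δSingle τ)
    rw [toFun_single, toFun_δSingle]
    exact ⟨(Set.finite_singleton τ).subset Set.support_indicator_subset, rfl⟩
  | zero => simp
  | add x y _ _ hx hy =>
    simp only [WithLp.add_fst, WithLp.add_snd, map_add, hx.2, hy.2, and_true]
    exact (hx.1.union hy.1).subset (Function.support_add _ _)
  | smul c x _ hx =>
    simp only [WithLp.smul_fst, WithLp.smul_snd, map_smul, hx.2, and_true]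
    exact hx.1.subset (Function.support_const_smul_subset _ _)

/-- The approximation defining `D(δ_D)` is convergence in the graph norm, which is the Hilbert norm
of `WithLp 2`. Conversely, limits of the finite graph stay in the graph of `δ`, because `δ f σ` is a
finite sum of point evaluations and hence continuous in `f`. -/
lemma mem_graph_coboundaryD_iff_mem_closure (f g : K.L2) : (f, g) ∈ d.coboundaryD.graph ↔
    WithLp.toLp 2 (f, g) ∈ d.finiteGraph.topologicalClosure := by
  rw [mem_graph_coboundaryD_iff]
  have hsq : ∀ p : WithLp 2 (K.L2 × K.L2), p ∈ d.finiteGraph → d.δ (K.toFun f) = K.toFun g →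
      K.sqNorm (K.toFun p.fst - K.toFun f) + d.upForm (K.toFun p.fst - K.toFun f) =
        ENNReal.ofReal (‖p - WithLp.toLp 2 (f, g)‖ ^ 2) := by
    intro p hp hfg
    rw [upForm, map_sub, (d.exists_of_mem_finiteGraph hp).2, hfg, ← map_sub, ← map_sub,
      sqNorm_toFun, sqNorm_toFun, ← ENNReal.ofReal_add (sq_nonneg _) (sq_nonneg _),
      WithLp.prod_norm_sq_eq_of_L2]
    rfl
  have hlim : ∀ p : ℕ → WithLp 2 (K.L2 × K.L2),
      Tendsto (fun n => ENNReal.ofReal (‖p n - WithLp.toLp 2 (f, g)‖ ^ 2)) atTop (𝓝 0) ↔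
        Tendsto p atTop (𝓝 (WithLp.toLp 2 (f, g))) := by
    intro p
    rw [tendsto_iff_norm_sub_tendsto_zero]
    constructor
    · intro h
      have h1 := (ENNReal.tendsto_toReal ENNReal.zero_ne_top).comp h
      have h2 := h1.sqrt
      simpa [Function.comp_def] using h2
    · intro h
      have h1 := ENNReal.tendsto_ofReal (h.pow 2)
      simpa using h1
  constructor
  · rintro ⟨⟨u, hu, hu'⟩, hfg⟩
    choose p hp hp1 hp2 using fun n => d.exists_mem_finiteGraph (hu n)
    refine mem_closure_of_tendsto ((hlim p).1 ?_) (Eventually.of_forall hp)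
    refine hu'.congr fun n => ?_
    rw [← hsq (p n) (hp n) hfg, hp1]
  · intro h
    obtain ⟨p, hp, hpl⟩ := mem_closure_iff_seq_limit.1 h
    have hfst : Tendsto (fun n => (p n).fst) atTop (𝓝 f) :=
      ((WithLp.prod_continuous_ofLp 2 K.L2 K.L2).fst.tendsto _).comp hpl
    have hsnd : Tendsto (fun n => (p n).snd) atTop (𝓝 g) :=
      ((WithLp.prod_continuous_ofLp 2 K.L2 K.L2).snd.tendsto _).comp hpl
    have hfg : d.δ (K.toFun f) = K.toFun g := by
      funext σ
      refine tendsto_nhds_unique (((d.continuous_δ_apply σ).tendsto f).comp hfst) ?_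
      refine (((K.continuous_toFun_apply σ).tendsto g).comp hsnd).congr fun n => ?_
      simp only [Function.comp_apply]
      rw [(d.exists_of_mem_finiteGraph (hp n)).2]
    refine ⟨⟨fun n => K.toFun (p n).fst, fun n => (d.exists_of_mem_finiteGraph (hp n)).1, ?_⟩, hfg⟩
    refine ((hlim p).2 hpl).congr fun n => ?_
    rw [hsq (p n) (hp n) hfg]

/-- The adjoint of `∂_N` is `δ_D`. -/
theorem mem_graph_coboundaryD_iff_adjoint (f g : K.L2) : (f, g) ∈ d.coboundaryD.graph ↔
    ∀ a b, (a, b) ∈ d.boundaryN.graph → inner ℂ f b = inner ℂ g a := by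
  rw [mem_graph_coboundaryD_iff_mem_closure, ← Submodule.orthogonal_orthogonal_eq_closure,
    Submodule.mem_orthogonal']
  constructor
  · intro h a b hab
    -- The rotation `(a, b) ↦ (-b, a)` carries the graph of `∂_N` onto the orthogonal complement of
    -- `finiteGraph`; the closure is the double complement.
    have h1 := h (WithLp.toLp 2 (-b, a)) ?_
    · rw [WithLp.prod_inner_apply] at h1
      simp only [inner_neg_right] at h1
      linear_combination -h1
    · rw [finiteGraph, Submodule.mem_orthogonal]
      intro u hu
      induction hu using Submodule.span_induction with
      | mem x hx =>
        obtain ⟨τ, rfl⟩ := hx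
        rw [WithLp.prod_inner_apply]
        simp only [inner_neg_right]
        linear_combination (d.mem_graph_boundaryN_iff a b).1 hab τ
      | zero => simp
      | add x y _ _ hx hy => rw [inner_add_left, hx, hy, add_zero]
      | smul c x _ hx => rw [inner_smul_left, hx, mul_zero]
  · intro h u hu
    have h1 : ((u.snd, -u.fst) : K.L2 × K.L2) ∈ d.boundaryN.graph := by
      rw [mem_graph_boundaryN_iff]
      intro τ
      have h2 := (Submodule.mem_orthogonal _ _).1 hu _ (Submodule.subset_span ⟨τ, rfl⟩)
      rw [WithLp.prod_inner_apply] at h2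
      rw [inner_neg_right]
      exact eq_neg_of_add_eq_zero_right h2
    have h3 := h _ _ h1
    rw [inner_neg_right] at h3
    rw [WithLp.prod_inner_apply]
    exact add_eq_zero_iff_neg_eq.2 h3

lemma single_mem_graph_coboundaryD (τ : K.Simplex) :
    (K.single τ, d.δSingle τ) ∈ d.coboundaryD.graph :=
  (d.mem_graph_coboundaryD_iff_mem_closure _ _).2
    (Submodule.le_topologicalClosure _ (Submodule.subset_span ⟨τ, rfl⟩))

/-- The adjoint of `δ_D` is `∂_N`. -/
theorem mem_graph_boundaryN_iff_adjoint (a b : K.L2) : (a, b) ∈ d.boundaryN.graph ↔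
    ∀ f g, (f, g) ∈ d.coboundaryD.graph → inner ℂ f b = inner ℂ g a :=
  ⟨fun h f g hfg => (d.mem_graph_coboundaryD_iff_adjoint f g).1 hfg a b h,
    fun h => (d.mem_graph_boundaryN_iff a b).2 fun τ =>
      (h _ _ (d.single_mem_graph_coboundaryD τ)).symm⟩

end WeightedComplex.Coboundary

namespace WeightedComplex

variable {X : Type*} [DecidableEq X] {K : WeightedComplex X}

/-! ### Cofaces and the link graph -/

/-- The simplex `vτ` for a vertex `v` of the link of `τ`. -/
def join (τ : K.Simplex) (v : K.link τ) : K.Simplex :=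
  ⟨insert v.1 τ.1, v.2.2, fun h => absurd h (Finset.insert_ne_empty _ _)⟩

lemma isFace_join (τ : K.Simplex) (v : K.link τ) : IsFace τ.1 (join τ v).1 :=
  ⟨Finset.subset_insert _ _, Finset.card_insert_of_notMem v.2.1⟩

lemma join_injective (τ : K.Simplex) : Function.Injective (join τ) := by
  intro v w h
  have e : insert v.1 τ.1 = insert w.1 τ.1 := congrArg Subtype.val h
  have h1 : v.1 ∈ insert w.1 τ.1 := e ▸ Finset.mem_insert_self v.1 τ.1
  exact Subtype.ext ((Finset.mem_insert.1 h1).resolve_right v.2.1)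

lemma exists_join_eq {τ σ : K.Simplex} (h : IsFace τ.1 σ.1) : ∃ v : K.link τ, join τ v = σ := by
  have h1 : (σ.1 \ τ.1).card = 1 := by
    rw [Finset.card_sdiff_of_subset h.1, h.2]
    omega
  obtain ⟨v, hv⟩ := Finset.card_eq_one.1 h1
  have hv' : v ∈ σ.1 \ τ.1 := hv ▸ Finset.mem_singleton_self v
  have e : insert v τ.1 = σ.1 := by
    rw [Finset.insert_eq, ← hv, Finset.sdiff_union_of_subset h.1]
  exact ⟨⟨v, (Finset.mem_sdiff.1 hv').2, e ▸ σ.2.1⟩, Subtype.ext e⟩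

/-- The cofaces of `τ` are the simplices `vτ`. -/
def linkEquiv (τ : K.Simplex) : K.link τ ≃ {σ : K.Simplex // IsFace τ.1 σ.1} :=
  Equiv.ofBijective (fun v => ⟨join τ v, isFace_join τ v⟩)
    ⟨fun _ _ h => join_injective τ (congrArg Subtype.val h), fun σ =>
      (exists_join_eq σ.2).imp fun _ h => Subtype.ext h⟩

/-- The vertices `v`, `v'` of the link of `τ` span an edge of the link. -/
def LinkAdj (τ : K.Simplex) (v v' : K.link τ) : Prop :=
  v ≠ v' ∧ insert v.1 (insert v'.1 τ.1) ∈ K.faces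

lemma LinkAdj.symm {τ : K.Simplex} {v v' : K.link τ} (h : LinkAdj τ v v') : LinkAdj τ v' v :=
  ⟨h.1.symm, Finset.insert_comm v.1 v'.1 τ.1 ▸ h.2⟩

/-- The simplex `vv'τ` for an edge of the link of `τ`. -/
def join₂ {τ : K.Simplex} {v v' : K.link τ} (h : LinkAdj τ v v') : K.Simplex :=
  ⟨insert v.1 (insert v'.1 τ.1), h.2, fun h => absurd h (Finset.insert_ne_empty _ _)⟩

lemma join₂_symm {τ : K.Simplex} {v v' : K.link τ} (h : LinkAdj τ v v') :
    join₂ h.symm = join₂ h :=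
  Subtype.ext (Finset.insert_comm v'.1 v.1 τ.1)

lemma LinkAdj.notMem {τ : K.Simplex} {v v' : K.link τ} (h : LinkAdj τ v v') :
    v'.1 ∉ insert v.1 τ.1 := by
  rw [Finset.mem_insert, not_or]
  exact ⟨fun e => h.1 (Subtype.ext e.symm), v'.2.1⟩

lemma isFace_join₂ {τ : K.Simplex} {v v' : K.link τ} (h : LinkAdj τ v v') :
    IsFace (join τ v).1 (join₂ h).1 := by
  refine ⟨Finset.insert_subset_insert _ (Finset.subset_insert _ _), ?_⟩
  change (insert v.1 (insert v'.1 τ.1)).card = (insert v.1 τ.1).card + 1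
  rw [Finset.insert_comm, Finset.card_insert_of_notMem h.notMem]

lemma join₂_right_injective {τ : K.Simplex} {v v' v'' : K.link τ} (h : LinkAdj τ v v')
    (h' : LinkAdj τ v v'') (e : join₂ h = join₂ h') : v' = v'' := by
  have h1 : v'.1 ∈ insert v.1 (insert v''.1 τ.1) := by
    have e' : insert v.1 (insert v'.1 τ.1) = insert v.1 (insert v''.1 τ.1) :=
      congrArg Subtype.val e
    rw [← e']
    exact Finset.mem_insert_of_mem (Finset.mem_insert_self _ _)
  rw [Finset.insert_comm] at h1
  exact Subtype.ext ((Finset.mem_insert.1 h1).resolve_right h.notMem)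

/-- The cofaces of `vτ` are the simplices `vv'τ`. -/
def linkEquiv₂ (τ : K.Simplex) (v : K.link τ) :
    {v' : K.link τ // LinkAdj τ v v'} ≃ {σ : K.Simplex // IsFace (join τ v).1 σ.1} :=
  Equiv.ofBijective (fun v' => ⟨join₂ v'.2, isFace_join₂ v'.2⟩) <| by
    refine ⟨fun v' v'' h => Subtype.ext (join₂_right_injective v'.2 v''.2
      (congrArg Subtype.val h)), fun σ => ?_⟩
    obtain ⟨w, hw⟩ := exists_join_eq σ.2
    have hσ : insert w.1 (insert v.1 τ.1) = σ.1.1 := congrArg Subtype.val hw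
    have hw1 : w.1 ∉ insert v.1 τ.1 := w.2.1
    have hwτ : w.1 ∉ τ.1 := fun h => hw1 (Finset.mem_insert_of_mem h)
    -- A coface of `vτ` has the form `wvτ`; passing to the subset `wτ` shows that `w` is a vertex of
    -- the link of `τ`.
    have hmem : insert w.1 τ.1 ∈ K.faces := K.down_closed _ σ.1.2.1 _ (by
      rw [← hσ]
      exact Finset.insert_subset_insert _ (Finset.subset_insert _ _))
    refine ⟨⟨⟨w.1, hwτ, hmem⟩, ?_, ?_⟩, Subtype.ext (Subtype.ext ?_)⟩
    · intro e
      exact hw1 (Finset.mem_insert.2 (Or.inl (congrArg Subtype.val e).symm))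
    · change insert v.1 (insert w.1 τ.1) ∈ K.faces
      rw [Finset.insert_comm, hσ]
      exact σ.1.2.1
    · change insert v.1 (insert w.1 τ.1) = _
      rw [Finset.insert_comm, hσ]

lemma linkGraph_b_of_adj {τ : K.Simplex} {v v' : K.link τ} (h : LinkAdj τ v v') :
    (K.linkGraph τ).b v v' = K.m (join₂ h) :=
  if_pos h

lemma linkGraph_b_of_not_adj {τ : K.Simplex} {v v' : K.link τ} (h : ¬ LinkAdj τ v v') :
    (K.linkGraph τ).b v v' = 0 :=
  if_neg h

open Classical in
-- An edge `(v, v')` is determined by the simplex `vv'τ` together with its vertex `v`. So each `σ`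
-- occurs at most `|σ| = |τ| + 2` times, and the sum is at most `(|τ| + 2) ‖a‖²`.
lemma summable_linkGraph_mul_norm_sq (τ : K.Simplex) (a : K.L2) :
    Summable fun p : K.link τ × K.link τ => (K.linkGraph τ).b p.1 p.2 *
      (if h : LinkAdj τ p.1 p.2 then ‖K.toFun a (join₂ h)‖ ^ 2 else 0) := by
  have hs : Summable fun q : Σ σ : K.Simplex, σ.1 =>
      if q.1.1.card = τ.1.card + 2 then K.m q.1 * ‖K.toFun a q.1‖ ^ 2 else 0 := by
    refine (summable_sigma_of_nonneg fun q => ?_).2 ⟨fun σ => (hasSum_fintype _).summable, ?_⟩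
    · split_ifs
      · exact mul_nonneg (m_pos _).le (sq_nonneg _)
      · exact le_rfl
    · simp only [tsum_fintype, Finset.sum_const, Finset.card_univ, Fintype.card_coe]
      refine Summable.of_nonneg_of_le (fun σ => ?_) (fun σ => ?_)
        ((K.hasSum_norm_sq a).summable.mul_left ((τ.1.card : ℝ) + 2))
      · have := mul_nonneg (m_pos σ).le (sq_nonneg ‖K.toFun a σ‖)
        split_ifs <;> positivity
      · have := mul_nonneg (m_pos σ).le (sq_nonneg ‖K.toFun a σ‖)
        split_ifs with h
        · rw [h, nsmul_eq_mul]
          push_cast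
          exact le_rfl
        · rw [smul_zero]
          positivity
  let f : {p : K.link τ × K.link τ // LinkAdj τ p.1 p.2} → Σ σ : K.Simplex, σ.1 :=
    fun p => ⟨join₂ p.2, p.1.1.1, Finset.mem_insert_self _ _⟩
  have hf : Function.Injective f := by
    rintro ⟨⟨v, v'⟩, h⟩ ⟨⟨w, w'⟩, h'⟩ e
    have hvw : v = w := by
      have : (f ⟨⟨v, v'⟩, h⟩).2.1 = (f ⟨⟨w, w'⟩, h'⟩).2.1 := by rw [e]
      exact Subtype.ext this
    subst hvw
    have := join₂_right_injective h h' (congrArg Sigma.fst e)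
    subst this
    rfl
  refine ((Function.Injective.summable_iff (Subtype.val_injective
    (p := fun p : K.link τ × K.link τ => LinkAdj τ p.1 p.2)) ?_).1 ?_)
  · intro p hp
    have : ¬ LinkAdj τ p.1 p.2 := fun h => hp ⟨⟨p, h⟩, rfl⟩
    rw [dif_neg this, mul_zero]
  · refine (hs.comp_injective hf).congr fun p => ?_
    have hc : (join₂ p.2).1.card = τ.1.card + 2 := by
      rw [(isFace_join₂ p.2).2, (isFace_join τ _).2]
    simp only [Function.comp_apply, f]
    rw [if_pos hc, dif_pos p.2, linkGraph_b_of_adj p.2]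

/-! ### Forms as flows on link graphs, and `∂_N ∂_N = 0`. -/

namespace Coboundary

variable (d : K.Coboundary)

/-- Evaluate `δδ 1_τ = 0` at `vv'τ`: the only simplices between `τ` and `vv'τ` are `vτ` and `v'τ`.
-/
lemma θ_mul_θ_add {τ : K.Simplex} {v v' : K.link τ} (h : LinkAdj τ v v') :
    d.θ τ (join τ v') * d.θ (join τ v') (join₂ h) =
      -(d.θ τ (join τ v) * d.θ (join τ v) (join₂ h)) := by
  have h0 : d.δ (d.θ τ) (join₂ h) = 0 := by
    have := congrFun (LinearMap.congr_fun d.δ_δ (Set.indicator {τ} 1)) (join₂ h)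
    exact this
  rw [d.apply_eq] at h0
  let s : {ρ : K.Simplex // IsFace ρ.1 (join₂ h).1} := ⟨join τ v, isFace_join₂ h⟩
  let s' : {ρ : K.Simplex // IsFace ρ.1 (join₂ h).1} :=
    ⟨join τ v', join₂_symm h ▸ isFace_join₂ h.symm⟩
  classical
  rw [finsum_eq_sum_of_support_subset (s := {s, s'})] at h0
  · rw [Finset.sum_pair] at h0
    · change d.θ (join τ v) (join₂ h) * d.θ τ (join τ v) +
        d.θ (join τ v') (join₂ h) * d.θ τ (join τ v') = 0 at h0
      linear_combination h0
    · intro e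
      exact h.1 (join_injective τ (congrArg Subtype.val e))
  · rintro ⟨ρ, hρ⟩ hne
    have hτρ : IsFace τ.1 ρ.1 := by
      by_contra hn
      exact hne (by simp [d.θ_eq_zero hn])
    obtain ⟨w, rfl⟩ := exists_join_eq hτρ
    have hw : w.1 ∈ insert v.1 (insert v'.1 τ.1) := hρ.1 (Finset.mem_insert_self _ _)
    simp only [Finset.mem_insert, w.2.1, or_false] at hw
    simp only [Finset.coe_insert, Finset.coe_singleton, Set.mem_insert_iff,
      Set.mem_singleton_iff, s, s']
    exact hw.imp (fun e => Subtype.ext (congrArg (join τ) (Subtype.ext e)))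
      (fun e => Subtype.ext (congrArg (join τ) (Subtype.ext e)))

open Classical in
/-- The flow on the link graph of `τ` induced by a form `a`, relative to the edge weights. -/
def linkFlow (τ : K.Simplex) (a : K.L2) (v v' : K.link τ) : ℂ :=
  if h : LinkAdj τ v v' then
    d.θ τ (join τ v) * d.θ (join τ v) (join₂ h) * K.toFun a (join₂ h) else 0

lemma linkFlow_symm (τ : K.Simplex) (a : K.L2) (v v' : K.link τ) :
    d.linkFlow τ a v' v = -d.linkFlow τ a v v' := by
  by_cases h : LinkAdj τ v v'
  · rw [linkFlow, linkFlow, dif_pos h, dif_pos h.symm, join₂_symm h, d.θ_mul_θ_add h, neg_mul]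
  · rw [linkFlow, linkFlow, dif_neg h, dif_neg fun h' => h h'.symm, neg_zero]

/-- The divergence of the flow at `v` is `∂a = b` evaluated at `vτ`, up to weight and sign. -/
lemma tsum_linkFlow {a b : K.L2} (hab : (a, b) ∈ d.boundaryN.graph) (τ : K.Simplex)
    (v : K.link τ) : ∑' v', ((K.linkGraph τ).b v v' : ℂ) * d.linkFlow τ a v v' =
      K.m (join τ v) * d.θ τ (join τ v) * K.toFun b (join τ v) := by
  have h := (d.mem_graph_boundaryN_iff a b).1 hab (join τ v)
  rw [inner_single, inner_δSingle, ← (linkEquiv₂ τ v).tsum_eq] at h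
  rw [mul_right_comm, ← h, mul_comm, ← tsum_mul_left]
  refine (tsum_subtype_eq_of_support_subset (s := {v' | LinkAdj τ v v'})
    (f := fun v' => ((K.linkGraph τ).b v v' : ℂ) * d.linkFlow τ a v v') ?_).symm.trans ?_
  · intro v' hv'
    by_contra hn
    exact hv' (by simp [linkGraph_b_of_not_adj (fun h => hn h)])
  · refine tsum_congr fun v' => ?_
    have hv' : LinkAdj τ v v'.1 := v'.2
    rw [linkGraph_b_of_adj hv', linkFlow, dif_pos hv']
    change _ = d.θ τ (join τ v) * (K.m (join₂ hv') * d.θ (join τ v) (join₂ hv') *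
      K.toFun a (join₂ hv'))
    ring

/-- If all connected components of all links are recurrent, then `range ∂_N` is orthogonal to the
coboundaries of finitely supported functions. -/
theorem inner_δSingle_boundaryN (hrec : K.RecurrentLinks) {a b : K.L2}
    (hab : (a, b) ∈ d.boundaryN.graph) (τ : K.Simplex) : inner ℂ (d.δSingle τ) b = 0 := by
  classical
  rw [inner_δSingle, ← (linkEquiv τ).tsum_eq]
  -- Absolute summability of the divergence comes from `b ∈ ℓ²`, not from the double sum over edges.
  have hsum : Summable fun v : K.link τ =>
      (K.m (join τ v) : ℂ) * d.θ τ (join τ v) * K.toFun b (join τ v) := by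
    refine Summable.of_norm_bounded
      ((linkEquiv τ).summable_iff.2 (summable_coface_mul_norm b τ)) fun v => ?_
    rw [norm_mul, norm_mul, d.norm_θ (isFace_join τ v), mul_one, Complex.norm_real,
      Real.norm_of_nonneg (m_pos _).le]
    exact le_rfl
  have h := (K.linkGraph τ).tsum_divergence_eq_zero_of_components (hrec τ) (d.linkFlow τ a)
    (fun v v' => by rw [linkFlow_symm, mul_neg])
    ((summable_linkGraph_mul_norm_sq τ a).congr fun p => ?_)
    (hsum.congr fun v => (d.tsum_linkFlow hab τ v).symm)
  · rw [← h]
    exact tsum_congr fun v => (d.tsum_linkFlow hab τ v).symm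
  · by_cases hp : LinkAdj τ p.1 p.2
    · rw [dif_pos hp, linkFlow, dif_pos hp, norm_mul, norm_mul, d.norm_θ (isFace_join τ _),
        d.norm_θ (isFace_join₂ hp), one_mul, one_mul]
    · rw [linkGraph_b_of_not_adj hp, zero_mul, zero_mul]

/-- This is `∂_N ∂_N = 0`, including that the range of `∂_N` lies in its domain. -/
theorem mem_graph_boundaryN_zero (hrec : K.RecurrentLinks) {a b : K.L2}
    (hab : (a, b) ∈ d.boundaryN.graph) : (b, 0) ∈ d.boundaryN.graph :=
  (d.mem_graph_boundaryN_iff b 0).2 fun τ => by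
    rw [d.inner_δSingle_boundaryN hrec hab τ, inner_zero_right]

end Coboundary

end WeightedComplex

/-! ### Graphs of unbounded operators -/

namespace LinearPMap

variable {H : Type*} [AddCommGroup H] [Module ℂ H]

lemma mem_opKer_iff (A : H →ₗ.[ℂ] H) (x : H) : x ∈ A.opKer ↔ (x, 0) ∈ A.graph := by
  rw [opKer, Submodule.mem_map, LinearPMap.mem_graph_iff]
  exact ⟨fun ⟨y, hy, e⟩ => ⟨y, e, hy⟩, fun ⟨y, e, hy⟩ => ⟨y, hy, e⟩⟩

lemma mem_opRange_iff (A : H →ₗ.[ℂ] H) (y : H) : y ∈ A.opRange ↔ ∃ x, (x, y) ∈ A.graph := by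
  rw [opRange, LinearMap.mem_range]
  exact ⟨fun ⟨x, e⟩ => ⟨x, (LinearPMap.mem_graph_iff A).2 ⟨x, rfl, e⟩⟩, fun ⟨_, h⟩ =>
    ((LinearPMap.mem_graph_iff A).1 h).imp fun _ h => h.2⟩

lemma mem_graph_opComp_iff (B A : H →ₗ.[ℂ] H) (x z : H) :
    (x, z) ∈ (B.opComp A).graph ↔ ∃ y, (x, y) ∈ A.graph ∧ (y, z) ∈ B.graph := by
  simp only [LinearPMap.mem_graph_iff]
  constructor
  · rintro ⟨w, rfl, rfl⟩
    obtain ⟨y, hy, e⟩ := w.2.1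
    exact ⟨A y, ⟨y, e, rfl⟩, ⟨A y, hy⟩, rfl, congrArg B (Subtype.ext
      (LinearPMap.domRestrict_apply (f := A) (x := w) (y := y) e.symm).symm)⟩
  · rintro ⟨y, ⟨x, rfl, rfl⟩, ⟨w, e, rfl⟩⟩
    refine ⟨⟨x.1, ⟨x, ?_, rfl⟩, x.2⟩, rfl, congrArg B (Subtype.ext ?_)⟩
    · exact (e ▸ w.2 : A x ∈ B.domain)
    · exact (LinearPMap.domRestrict_apply (f := A) (y := x) rfl).trans e.symm

lemma mem_graph_add_iff (A B : H →ₗ.[ℂ] H) (x z : H) :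
    (x, z) ∈ (A + B).graph ↔ ∃ y y', (x, y) ∈ A.graph ∧ (x, y') ∈ B.graph ∧ y + y' = z := by
  simp only [LinearPMap.mem_graph_iff]
  constructor
  · rintro ⟨w, rfl, rfl⟩
    exact ⟨A ⟨w.1, w.2.1⟩, B ⟨w.1, w.2.2⟩, ⟨_, rfl, rfl⟩, ⟨_, rfl, rfl⟩, rfl⟩
  · rintro ⟨_, _, ⟨a, ha, rfl⟩, ⟨b, hb, rfl⟩, rfl⟩
    obtain ⟨a, ha'⟩ := a
    obtain ⟨b, hb'⟩ := b
    subst ha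
    subst hb
    exact ⟨⟨b, ha', hb'⟩, rfl, rfl⟩

end LinearPMap

/-! ### The weak Hodge decomposition in Hilbert spaces -/

section Hilbert

variable {H : Type*} [NormedAddCommGroup H] [InnerProductSpace ℂ H]

/-- The adjoint relation with `g = 0`. -/
lemma LinearPMap.opKer_eq_orthogonal {T S : H →ₗ.[ℂ] H}
    (hT : ∀ f g, (f, g) ∈ T.graph ↔ ∀ a b, (a, b) ∈ S.graph → inner ℂ f b = inner ℂ g a) :
    T.opKer = S.opRangeᗮ := by
  ext x
  rw [mem_opKer_iff, hT, Submodule.mem_orthogonal']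
  constructor
  · intro h u hu
    obtain ⟨a, ha⟩ := (mem_opRange_iff S u).1 hu
    rw [h a u ha, inner_zero_left]
  · intro h a b hab
    rw [h b ((mem_opRange_iff S b).2 ⟨a, hab⟩), inner_zero_left]

/-- `ker (T S + S T) = ker T ∩ ker S` for adjoint operators `T` and `S`. -/
lemma LinearPMap.opKer_opComp_add_opComp {T S : H →ₗ.[ℂ] H}
    (hTS : ∀ f g, (f, g) ∈ T.graph → ∀ a b, (a, b) ∈ S.graph → inner ℂ f b = inner ℂ g a) :
    (T.opComp S + S.opComp T).opKer = T.opKer ⊓ S.opKer := by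
  ext x
  simp only [Submodule.mem_inf, mem_opKer_iff, mem_graph_add_iff, mem_graph_opComp_iff]
  constructor
  · rintro ⟨y, y', ⟨u, hu, huy⟩, ⟨w, hw, hwy⟩, e⟩
    -- Here `u = S x` and `w = T x`; pairing `(T S + S T) x = 0` with `x` gives `‖S x‖² + ‖T x‖² =
    -- 0`.
    have h1 : inner ℂ u u = inner ℂ y x := hTS _ _ huy _ _ hu
    have h2 : inner ℂ w w = inner ℂ y' x := by
      rw [← inner_conj_symm y' x, hTS _ _ hw _ _ hwy, inner_conj_symm]
    have h3 : (inner ℂ u u : ℂ) + inner ℂ w w = 0 := by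
      rw [h1, h2, ← inner_add_left, e, inner_zero_left]
    rw [inner_self_eq_norm_sq_to_K, inner_self_eq_norm_sq_to_K] at h3
    have h4 : ‖u‖ ^ 2 + ‖w‖ ^ 2 = 0 := by
      apply Complex.ofReal_injective
      push_cast
      exact h3
    have hu0 : u = 0 := by
      rw [← norm_eq_zero]
      nlinarith [sq_nonneg ‖u‖, sq_nonneg ‖w‖]
    have hw0 : w = 0 := by
      rw [← norm_eq_zero]
      nlinarith [sq_nonneg ‖u‖, sq_nonneg ‖w‖]
    exact ⟨hw0 ▸ hw, hu0 ▸ hu⟩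
  · rintro ⟨h1, h2⟩
    exact ⟨0, 0, ⟨0, h2, T.graph.zero_mem⟩, ⟨0, h1, S.graph.zero_mem⟩, add_zero 0⟩

/-- Project onto the closure of `R`, then project the remainder onto the closure of `Q`. That
closure lies in `Rᗮ`, so the second step does not spoil orthogonality to `R`. -/
lemma Submodule.orthogonal_inf_sup_closure_sup_closure [CompleteSpace H] {R Q : Submodule ℂ H}
    (h : Q ≤ Rᗮ) : Rᗮ ⊓ Qᗮ ⊔ R.topologicalClosure ⊔ Q.topologicalClosure = ⊤ := by
  have hR := R.isClosed_topologicalClosure.completeSpace_coe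
  have hQ := Q.isClosed_topologicalClosure.completeSpace_coe
  refine eq_top_iff.2 fun x _ => ?_
  set r := R.topologicalClosure.starProjection x
  set q := Q.topologicalClosure.starProjection (x - r)
  have hr : r ∈ R.topologicalClosure := Submodule.starProjection_apply_mem _ _
  have hq : q ∈ Q.topologicalClosure := Submodule.starProjection_apply_mem _ _
  have hxr : x - r ∈ Rᗮ := by
    rw [← Submodule.orthogonal_closure]
    exact Submodule.sub_starProjection_mem_orthogonal x
  have hqR : q ∈ Rᗮ :=
    Submodule.topologicalClosure_minimal Q h (Submodule.isClosed_orthogonal R) hq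
  have hz : x - r - q ∈ Rᗮ ⊓ Qᗮ := by
    refine ⟨sub_mem hxr hqR, ?_⟩
    rw [← Submodule.orthogonal_closure]
    exact Submodule.sub_starProjection_mem_orthogonal (x - r)
  have e : x = (x - r - q) + r + q := by abel
  rw [e]
  exact Submodule.add_mem_sup (Submodule.add_mem_sup hz hr) hq

/-- The quotient of a closed subspace `A` by a closed subspace `B ≤ A` is isometrically isomorphic
to `A ∩ Bᗮ`. -/
lemma Submodule.exists_quotient_linearIsometryEquiv [CompleteSpace H] {A B N : Submodule ℂ H}
    (hA : IsClosed (A : Set H)) (hB : IsClosed (B : Set H)) (hBA : B ≤ A) (hN : N = A ⊓ Bᗮ) :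
    ∃ Φ : (A ⧸ B.submoduleOf A) ≃ₗᵢ[ℂ] N,
      ∀ ω : A, (ω : H) - (Φ (Submodule.Quotient.mk ω) : H) ∈ B := by
  have := hA.completeSpace_coe
  set B' := B.submoduleOf A
  have hB' : IsClosed (B' : Set A) := hB.preimage continuous_subtype_val
  have := hB'.completeSpace_coe
  have hmap : B'ᗮ.map A.subtype = N := by
    ext x
    rw [hN, Submodule.mem_map, Submodule.mem_inf]
    constructor
    · rintro ⟨y, hy, rfl⟩
      refine ⟨y.2, fun u hu => ?_⟩
      exact hy ⟨u, hBA hu⟩ hu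
    · rintro ⟨hx, hx'⟩
      exact ⟨⟨x, hx⟩, fun u hu => hx' u.1 hu, rfl⟩
  let e : B'ᗮ ≃ₗᵢ[ℂ] N :=
    { toLinearEquiv := (Submodule.equivMapOfInjective A.subtype A.injective_subtype B'ᗮ).trans
        (LinearEquiv.ofEq _ _ hmap)
      norm_map' := fun x => rfl }
  refine ⟨B'.quotientEquivOrthogonal.trans e, fun ω => ?_⟩
  have h : (Submodule.Quotient.mk (B'.quotientEquivOrthogonal (Submodule.Quotient.mk ω) : A) :
      A ⧸ B') = Submodule.Quotient.mk ω :=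
    Submodule.mk_quotientEquivOfIsCompl_apply B'.isCompl_orthogonal _
  exact (Submodule.Quotient.eq B').1 h.symm

end Hilbert

/-! ### Kernels, ranges and degrees of the operators of a complex. -/

namespace WeightedComplex.Coboundary

variable {X : Type*} {K : WeightedComplex X} (d : K.Coboundary)

lemma opKer_coboundaryD : d.coboundaryD.opKer = d.boundaryN.opRangeᗮ :=
  LinearPMap.opKer_eq_orthogonal d.mem_graph_coboundaryD_iff_adjoint

lemma opKer_boundaryN : d.boundaryN.opKer = d.coboundaryD.opRangeᗮ := by
  refine LinearPMap.opKer_eq_orthogonal fun a b => (d.mem_graph_boundaryN_iff_adjoint a b).trans ?_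
  refine forall_congr' fun f => forall_congr' fun g => imp_congr_right fun _ => ?_
  rw [← inner_conj_symm f b, ← inner_conj_symm g a, (starRingEnd ℂ).injective.eq_iff, eq_comm]

lemma opKer_laplacian : d.laplacian.opKer = d.coboundaryD.opKer ⊓ d.boundaryN.opKer :=
  LinearPMap.opKer_opComp_add_opComp fun f g h =>
    (d.mem_graph_coboundaryD_iff_adjoint f g).1 h

/-- The point where recurrence enters the Hilbert space argument. -/
lemma opRange_boundaryN_le [DecidableEq X] (hrec : K.RecurrentLinks) :
    d.boundaryN.opRange ≤ d.coboundaryD.opRangeᗮ := by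
  rw [← opKer_boundaryN]
  intro b hb
  obtain ⟨a, hab⟩ := (LinearPMap.mem_opRange_iff _ b).1 hb
  exact (LinearPMap.mem_opKer_iff _ b).2 (d.mem_graph_boundaryN_zero hrec hab)

lemma mem_opKer_coboundaryDLevel_iff (k : ℤ) (x : K.L2) :
    x ∈ (d.coboundaryDLevel k).opKer ↔ x ∈ K.level k ∧ x ∈ d.coboundaryD.opKer := by
  rw [LinearPMap.mem_opKer_iff, coboundaryDLevel, LinearPMap.mem_graph_domRestrict,
    LinearPMap.mem_opKer_iff]

lemma mem_opKer_laplacianLevel_iff (k : ℤ) (x : K.L2) :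
    x ∈ (d.laplacianLevel k).opKer ↔ x ∈ K.level k ∧ x ∈ d.laplacian.opKer := by
  rw [LinearPMap.mem_opKer_iff, laplacianLevel, LinearPMap.mem_graph_domRestrict,
    LinearPMap.mem_opKer_iff]

lemma mem_opRange_coboundaryDLevel_iff (k : ℤ) (y : K.L2) :
    y ∈ (d.coboundaryDLevel k).opRange ↔ ∃ x ∈ K.level k, (x, y) ∈ d.coboundaryD.graph := by
  simp only [LinearPMap.mem_opRange_iff, coboundaryDLevel, LinearPMap.mem_graph_domRestrict]

lemma opRange_coboundaryDLevel_le (k : ℤ) :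
    (d.coboundaryDLevel k).opRange ≤ d.coboundaryD.opRange := by
  intro y hy
  obtain ⟨x, _, hxy⟩ := (d.mem_opRange_coboundaryDLevel_iff k y).1 hy
  exact (LinearPMap.mem_opRange_iff _ y).2 ⟨x, hxy⟩

/-- If `δx` is nonzero at `σ`, then `x` is nonzero at some face of `σ`, which has one vertex less.
-/
lemma opRange_coboundaryDLevel_le_level (k : ℤ) :
    (d.coboundaryDLevel (k - 1)).opRange ≤ K.level k := by
  intro y hy
  obtain ⟨x, hx, hxy⟩ := (d.mem_opRange_coboundaryDLevel_iff _ y).1 hy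
  have e := ((d.mem_graph_coboundaryD_iff x y).1 hxy).2
  intro σ hσ
  rw [← e, d.apply_eq] at hσ
  obtain ⟨τ, hτ⟩ := not_forall.1 (mt finsum_eq_zero_of_forall_eq_zero hσ)
  have h1 := hx τ.1 (right_ne_zero_of_mul hτ)
  have h2 := τ.2.2
  omega

lemma single_mem_level (τ : K.Simplex) : K.single τ ∈ K.level (τ.1.card - 1) := by
  intro σ hσ
  rw [toFun_single] at hσ
  obtain rfl : σ = τ := by
    by_contra h
    exact hσ (Set.indicator_of_notMem (s := {τ}) h _)
  omega

/-- A `k`-form orthogonal to `range δ_{D,k-1}` is in the kernel of `∂_N`. -/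
lemma mem_opKer_boundaryN_of_level {k : ℤ} {x : K.L2} (hx : x ∈ K.level k)
    (h : x ∈ (d.coboundaryDLevel (k - 1)).opRangeᗮ) : x ∈ d.boundaryN.opKer := by
  rw [LinearPMap.mem_opKer_iff, mem_graph_boundaryN_iff]
  intro τ
  rw [inner_zero_right]
  -- A simplex of `level (k - 1)` has `k` vertices. For such `τ`, `δ 1_τ` lies in `range δ_{D,k-1}`;
  -- for any other `τ`, the form `x` vanishes on all cofaces of `τ`.
  by_cases hτ : (τ.1.card : ℤ) = k
  · refine (Submodule.mem_orthogonal _ _).1 h _ ((d.mem_opRange_coboundaryDLevel_iff _ _).2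
      ⟨K.single τ, ?_, d.single_mem_graph_coboundaryD τ⟩)
    exact hτ ▸ single_mem_level τ
  · rw [inner_δSingle]
    refine (tsum_congr fun σ => ?_).trans tsum_zero
    have h0 : K.toFun x σ.1 = 0 := by
      by_contra hne
      have h1 := hx σ.1 hne
      have h2 := σ.2.2
      omega
    rw [h0, mul_zero]

end WeightedComplex.Coboundary

end

theorem mainTheorem6 {X : Type*} [DecidableEq X] (K : WeightedComplex X) (d : K.Coboundary)
    (hrec : K.RecurrentLinks) :
    (d.laplacian.opKer ⟂ d.coboundaryD.opRange.topologicalClosure ∧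
      d.laplacian.opKer ⟂ d.boundaryN.opRange.topologicalClosure ∧
      d.coboundaryD.opRange.topologicalClosure ⟂ d.boundaryN.opRange.topologicalClosure ∧
      d.laplacian.opKer ⊔ d.coboundaryD.opRange.topologicalClosure
        ⊔ d.boundaryN.opRange.topologicalClosure = ⊤) ∧
    ∀ k : ℤ, 0 ≤ k →
      (d.coboundaryDLevel (k - 1)).opRange.topologicalClosure ≤ (d.coboundaryDLevel k).opKer ∧
      ∃ Φ : d.RelCohomology k ≃ₗᵢ[ℂ] (d.laplacianLevel k).opKer,
        ∀ ω : (d.coboundaryDLevel k).opKer,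
          (ω : K.L2) - (Φ (Submodule.Quotient.mk ω) : K.L2) ∈
            (d.coboundaryDLevel (k - 1)).opRange.topologicalClosure := by
  have hle := d.opRange_boundaryN_le hrec
  have hker : d.laplacian.opKer = d.coboundaryD.opRangeᗮ ⊓ d.boundaryN.opRangeᗮ := by
    rw [d.opKer_laplacian, d.opKer_coboundaryD, d.opKer_boundaryN, inf_comm]
  refine ⟨⟨?_, ?_, ?_, ?_⟩, fun k _ => ?_⟩
  · rw [Submodule.isOrtho_iff_le, Submodule.orthogonal_closure, hker]
    exact inf_le_left
  · rw [Submodule.isOrtho_iff_le, Submodule.orthogonal_closure, hker]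
    exact inf_le_right
  · rw [Submodule.isOrtho_comm, Submodule.isOrtho_iff_le, Submodule.orthogonal_closure]
    exact Submodule.topologicalClosure_minimal _ hle (Submodule.isClosed_orthogonal _)
  · rw [hker]
    exact Submodule.orthogonal_inf_sup_closure_sup_closure hle
  · have hA : (d.coboundaryDLevel k).opKer = K.level k ⊓ d.boundaryN.opRangeᗮ := by
      ext x
      rw [d.mem_opKer_coboundaryDLevel_iff, d.opKer_coboundaryD, Submodule.mem_inf]
    have hAc : IsClosed ((d.coboundaryDLevel k).opKer : Set K.L2) := by
      rw [hA]
      exact (K.isClosed_level k).inter (Submodule.isClosed_orthogonal _)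
    have hBA : (d.coboundaryDLevel (k - 1)).opRange.topologicalClosure ≤
        (d.coboundaryDLevel k).opKer := by
      refine Submodule.topologicalClosure_minimal _ ?_ hAc
      rw [hA]
      -- The orthogonality of the two ranges, read in the other direction, puts `range δ_D` into
      -- `(range ∂_N)ᗮ = ker δ_D`.
      exact le_inf (d.opRange_coboundaryDLevel_le_level k)
        ((d.opRange_coboundaryDLevel_le _).trans (Submodule.isOrtho_iff_le.2 hle).symm.le)
    refine ⟨hBA, Submodule.exists_quotient_linearIsometryEquiv hAc
      (Submodule.isClosed_topologicalClosure _) hBA ?_⟩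
    -- It remains to see that `ker Δ_k` is the part of `ker δ_{D,k}` orthogonal to `range
    -- δ_{D,k-1}`; on `k`-forms this orthogonality is the same as `∂_N x = 0`.
    ext x
    rw [Submodule.orthogonal_closure, Submodule.mem_inf, d.mem_opKer_laplacianLevel_iff,
      d.mem_opKer_coboundaryDLevel_iff, d.opKer_laplacian, Submodule.mem_inf]
    constructor
    · rintro ⟨h1, h2, h3⟩
      refine ⟨⟨h1, h2⟩, Submodule.orthogonal_le (d.opRange_coboundaryDLevel_le _) ?_⟩
      rwa [← d.opKer_boundaryN]
    · rintro ⟨⟨h1, h2⟩, h3⟩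
      exact ⟨h1, h2, d.mem_opKer_boundaryN_of_level h1 h3⟩
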